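/- Let $M'=\mathbb{Z}^5$ with dual lattice $N'=\mathbb{Z}^5$ (dual bases, $N'_{\mathbb R}=\mathbb R^5$), with dual basis $e_1^*,\dots,e_5^*$ of $N'$. Let $\nabla\subseteq N'_{\mathbb R}$ be the convex hull of $\nabla_1\cup\nabla_2$, where $$\nabla_1=\mathrm{Conv}\{(-1,-1,-1,-1,0),(3,-1,-1,-1,0),(-1,3,-1,-1,0),(-1,-1,3,-1,0),(-1,-1,-1,3,0),(-1,-1,-1,-1,4)\},$$ $$\nabla_2=\mathrm{Conv}\{(0,0,0,0,-1),(2,0,0,0,-1),(0,2,0,0,-1),(0,0,2,0,-1),(0,0,0,2,-1),(0,0,0,0,1)\}.$$ Let $\Sigma(\nabla)$ be the fan of cones over the proper faces of $\nabla$ (the cone over the empty face being $\{0\}$), and let $X(\nabla)$ be the corresponding toric variety over $\mathbb C$. For $i=1,2$ let $\varphi^i:N'_{\mathbb R}\to\mathbb R$ be the function, linear on each cone of $\Sigma(\nabla)$, with value $1$ at the listed vertices of $\nabla_i$ and $0$ at the listed vertices of the other polytope $\nabla_j$. Let $\mathcal L_i$ be the line bundle on $X(\nabla)$ associated to $\varphi^i$,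 with the convention that the lattice points $m\in M'$ of $$\mathrm{Newt}(\varphi^i)=\{u:\langle u,v\rangle\ge-\varphi^i(v)\ \text{for all } v\in N'_{\mathbb R}\}$$ give the monomial global sections $z^m$ of $\mathcal L_i$. Let $\Sigma'(\nabla)\subseteq\Sigma(\nabla)$ be the subfan of the cones over those proper faces $f$ of $\nabla$ that contain neither $-e_5^*=(0,0,0,0,-1)$ nor $e_5^*=(0,0,0,0,1)$ and do not contain the segment $\mathrm{Conv}((-1,-1,-1,-1,0),(-1,-1,-1,-1,4))$. Then $X(\Sigma'(\nabla))$ is an open subvariety of $X(\nabla)$, and the following hold. 1. For generic $(s_1,s_2)\in\Gamma(X(\nabla),\mathcal L_1)\times\Gamma(X(\nabla),\mathcal L_2)$ (that is, for all pairs in some nonempty Zariski open subset), the subvariety $V=\{s_1=s_2=0\}\subseteq X(\nabla)$ is contained in $X(\Sigma'(\nabla))$. 2. For every cone $\sigma\in\Sigma(\nabla)\setminus\Sigma'(\nabla)$ with torus orbit $T(\sigma)$, exactly one monomial global section $z^m$ of $\mathcal L_2$, $m\in\mathrm{Newt}(\varphi^2)\cap M'$, vanishes nowhere on $T(\sigma)$,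 and every other one vanishes identically on $T(\sigma)$. -/

import Mathlib

open AlgebraicGeometry CategoryTheory CategoryTheory.Limits

noncomputable section

namespace Toric

/-! ### Lattices and pairing -/

/-- The inclusion of the lattice `ℤⁿ` into `ℝⁿ`. -/
def toReal {n : ℕ} (m : Fin n → ℤ) : Fin n → ℝ := fun i => (m i : ℝ)

/-- The duality pairing `⟨m, v⟩` of `m ∈ M = ℤⁿ` with `v ∈ N_ℝ = ℝⁿ` (in dual bases). -/
def pairing {n : ℕ} (m : Fin n → ℤ) (v : Fin n → ℝ) : ℝ := toReal m ⬝ᵥ v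

section pairingLemmas

variable {n : ℕ}

lemma toReal_add (a b : Fin n → ℤ) : toReal (a + b) = toReal a + toReal b := by
  ext i; simp [toReal]

lemma toReal_neg (a : Fin n → ℤ) : toReal (-a) = -toReal a := by
  ext i; simp [toReal]

lemma pairing_add (a b : Fin n → ℤ) (v : Fin n → ℝ) :
    pairing (a + b) v = pairing a v + pairing b v := by
  simp [pairing, toReal_add, add_dotProduct]

lemma pairing_neg (a : Fin n → ℤ) (v : Fin n → ℝ) : pairing (-a) v = -pairing a v := by
  simp [pairing, toReal_neg, neg_dotProduct]

lemma pairing_sub (a b : Fin n → ℤ) (v : Fin n → ℝ) :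
    pairing (a - b) v = pairing a v - pairing b v := by
  rw [sub_eq_add_neg, pairing_add, pairing_neg, sub_eq_add_neg]

lemma pairing_zero (v : Fin n → ℝ) : pairing (0 : Fin n → ℤ) v = 0 := by
  simp [pairing, toReal, dotProduct]

lemma pairing_nsmul (k : ℕ) (a : Fin n → ℤ) (v : Fin n → ℝ) :
    pairing (k • a) v = k * pairing a v := by
  induction k with
  | zero => simp [pairing_zero]
  | succ k ih => rw [succ_nsmul, pairing_add, ih]; push_cast; ring

lemma pairing_toReal (a v : Fin n → ℤ) : pairing a (toReal v) = ((∑ i, a i * v i : ℤ) : ℝ) := by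
  simp [pairing, toReal, dotProduct]

/-- A linear form which is nonnegative on a cone generated by `S` is determined by `S`. -/
lemma nonneg_on_hull {S : Set (Fin n → ℝ)} {u : Fin n → ℝ} (h : ∀ v ∈ S, 0 ≤ u ⬝ᵥ v) :
    ∀ v ∈ PointedCone.hull ℝ S, 0 ≤ u ⬝ᵥ v := by
  intro v hv
  induction hv using Submodule.span_induction with
  | mem x hx => exact h x hx
  | zero => simp
  | add x y _ _ hx hy => rw [dotProduct_add]; positivity
  | smul a x _ hx =>
    have : a • x = (a : ℝ) • x := rfl
    rw [this, dotProduct_smul, smul_eq_mul]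
    exact mul_nonneg a.2 hx

lemma eq_on_hull {S : Set (Fin n → ℝ)} {u w : Fin n → ℝ} (h : ∀ v ∈ S, u ⬝ᵥ v = w ⬝ᵥ v) :
    ∀ v ∈ PointedCone.hull ℝ S, u ⬝ᵥ v = w ⬝ᵥ v := by
  intro v hv
  have h1 := nonneg_on_hull (u := u - w) (S := S)
    (fun v hv => by rw [sub_dotProduct, h v hv, sub_self]) v hv
  have h2 := nonneg_on_hull (u := w - u) (S := S)
    (fun v hv => by rw [sub_dotProduct, h v hv, sub_self]) v hv
  rw [sub_dotProduct] at h1 h2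
  linarith

end pairingLemmas

/-! ### Fans -/

/-- `τ` is a face of `σ`: it is cut out of `σ` by a supporting hyperplane. -/
def IsFace {n : ℕ} (τ σ : PointedCone ℝ (Fin n → ℝ)) : Prop :=
  ∃ u : Fin n → ℝ, (∀ v ∈ σ, 0 ≤ u ⬝ᵥ v) ∧ ∀ v, v ∈ τ ↔ v ∈ σ ∧ u ⬝ᵥ v = 0

/-- A fan in `N_ℝ = ℝⁿ` with respect to the lattice `N = ℤⁿ`: a finite nonempty collection of
strongly convex rational polyhedral cones, closed under taking faces, any two of which
intersect in a common face. -/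
structure Fan (n : ℕ) where
  cones : Set (PointedCone ℝ (Fin n → ℝ))
  finite : cones.Finite
  nonempty : cones.Nonempty
  rational : ∀ σ ∈ cones, ∃ S : Finset (Fin n → ℤ),
    σ = PointedCone.hull ℝ (toReal '' (S : Set (Fin n → ℤ)))
  salient : ∀ σ ∈ cones, ∀ v ∈ σ, -v ∈ σ → v = 0
  face_mem : ∀ σ ∈ cones, ∀ τ, IsFace τ σ → τ ∈ cones
  inter_isFace : ∀ σ ∈ cones, ∀ τ ∈ cones, IsFace (σ ⊓ τ) σ

/-! ### Semigroup algebras of dual cones -/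

/-- The semigroup `σ^∨ ∩ M` of lattice points of the dual cone. -/
def dualSemigroup {n : ℕ} (σ : PointedCone ℝ (Fin n → ℝ)) : AddSubmonoid (Fin n → ℤ) where
  carrier := {m | ∀ v ∈ σ, 0 ≤ pairing m v}
  zero_mem' := fun v _ => (pairing_zero v).ge
  add_mem' := fun {a b} ha hb v hv => by
    rw [pairing_add]; exact add_nonneg (ha v hv) (hb v hv)

lemma dualSemigroup_anti {n : ℕ} {τ σ : PointedCone ℝ (Fin n → ℝ)} (h : τ ≤ σ) :
    dualSemigroup σ ≤ dualSemigroup τ := fun _ hm v hv => hm v (h hv)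

/-- The coordinate ring `ℂ[σ^∨ ∩ M]` of the affine toric variety `U_σ`. -/
abbrev CoordRing {n : ℕ} (σ : PointedCone ℝ (Fin n → ℝ)) : Type :=
  AddMonoidAlgebra ℂ (dualSemigroup σ)

/-- The character `χ^m = z^m` for `m ∈ σ^∨ ∩ M`, a regular function on `U_σ`. -/
def chi {n : ℕ} {σ : PointedCone ℝ (Fin n → ℝ)} (m : dualSemigroup σ) : CoordRing σ :=
  AddMonoidAlgebra.single m 1

/-- Restriction of functions `ℂ[σ^∨ ∩ M] → ℂ[τ^∨ ∩ M]` from `U_σ` to `U_τ` for `τ ⊆ σ`,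
`χ^m ↦ χ^m`. -/
def restrict {n : ℕ} {τ σ : PointedCone ℝ (Fin n → ℝ)} (h : τ ≤ σ) :
    CoordRing σ →ₐ[ℂ] CoordRing τ :=
  AddMonoidAlgebra.mapDomainAlgHom ℂ ℂ (AddSubmonoid.inclusion (dualSemigroup_anti h))

section rings

variable {n : ℕ} {τ σ ρ : PointedCone ℝ (Fin n → ℝ)}

lemma restrict_chi (h : τ ≤ σ) (m : dualSemigroup σ) :
    restrict h (chi m) = chi ⟨m.1, dualSemigroup_anti h m.2⟩ := by
  simp [restrict, chi, AddMonoidAlgebra.mapDomain_single]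
  rfl

lemma chi_mul (a b : dualSemigroup σ) : chi a * chi b = chi (a + b) := by
  simp [chi, AddMonoidAlgebra.single_mul_single]

lemma chi_zero : chi (0 : dualSemigroup σ) = 1 := rfl

lemma chi_pow (a : dualSemigroup σ) (k : ℕ) : chi a ^ k = chi (k • a) := by
  simp [chi, AddMonoidAlgebra.single_pow]

lemma restrict_refl (x : CoordRing σ) : restrict le_rfl x = x := by
  have : AddSubmonoid.inclusion (dualSemigroup_anti (le_refl σ)) = AddMonoidHom.id _ := rfl
  simp [restrict, this]

lemma restrict_trans (h : τ ≤ σ) (h' : ρ ≤ τ) (x : CoordRing σ) :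
    restrict h' (restrict h x) = restrict (h'.trans h) x := by
  induction x using AddMonoidAlgebra.induction_linear with
  | zero => simp
  | add f g hf hg => simp only [map_add, hf, hg]
  | single m r =>
    simp only [restrict, AddMonoidAlgebra.mapDomainAlgHom_apply,
      AddMonoidAlgebra.mapDomain_single]
    rfl

lemma restrict_injective (h : τ ≤ σ) : Function.Injective (restrict h) :=
  AddMonoidAlgebra.mapDomain_injective (AddSubmonoid.inclusion_injective _)

end rings

/-! ### Gluing -/

/-- A real supporting linear form of finitely many lattice vectors can be replaced by an
integral one with the same zeros. -/
lemma exists_integral_form {n : ℕ} (S : Finset (Fin n → ℤ)) (u : Fin n → ℝ)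
    (hu : ∀ v ∈ S, 0 ≤ u ⬝ᵥ toReal v) :
    ∃ m : Fin n → ℤ, ∀ v ∈ S, 0 ≤ pairing m (toReal v) ∧
      (pairing m (toReal v) = 0 ↔ u ⬝ᵥ toReal v = 0) := by
  classical
  let W : Submodule ℚ ℝ := Submodule.span ℚ (Set.range u)
  have : FiniteDimensional ℚ W := FiniteDimensional.span_of_finite ℚ (Set.finite_range u)
  let b := Module.finBasis ℚ W
  let x : Fin n → W := fun i => ⟨u i, Submodule.subset_span ⟨i, rfl⟩⟩
  let c : Fin n → Fin (Module.finrank ℚ W) → ℚ := fun i j => b.repr (x i) j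
  have hux : ∀ i, u i = ∑ j, (c i j : ℝ) * (b j : ℝ) := by
    intro i
    have := congrArg (Subtype.val) (b.sum_repr (x i))
    simp only [x] at this
    rw [← this]
    simp only [c, x, AddSubmonoidClass.coe_finsetSum, SetLike.val_smul, Rat.smul_def]
  let d : (Fin n → ℤ) → Fin (Module.finrank ℚ W) → ℚ := fun v j => ∑ i, c i j * v i
  let F : (Fin n → ℤ) → (Fin (Module.finrank ℚ W) → ℝ) → ℝ := fun v r => ∑ j, (d v j : ℝ) * r j
  have hF : ∀ v (r : Fin (Module.finrank ℚ W) → ℝ),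
      ∑ i, (∑ j, (c i j : ℝ) * r j) * (v i : ℝ) = F v r := by
    intro v r
    simp only [F, d, Finset.sum_mul]
    rw [Finset.sum_comm]
    refine Finset.sum_congr rfl fun j _ => ?_
    push_cast
    rw [Finset.sum_mul]
    exact Finset.sum_congr rfl fun i _ => by ring
  have hFu : ∀ v, u ⬝ᵥ toReal v = F v (fun j => (b j : ℝ)) := by
    intro v
    rw [← hF]
    simp only [dotProduct, toReal]
    exact Finset.sum_congr rfl fun i _ => by rw [← hux]
  have hzero : ∀ v, u ⬝ᵥ toReal v = 0 → ∀ r, F v r = 0 := by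
    intro v hv r
    have h0 : ∑ j, d v j • b j = 0 := by
      apply Subtype.ext
      rw [hFu] at hv
      simpa [F, Rat.smul_def] using hv
    have := Fintype.linearIndependent_iff.mp b.linearIndependent _ h0
    simp [F, this]
  have hcont : ∀ v, Continuous (F v) := by
    intro v; simp only [F]; fun_prop
  let U : Set (Fin (Module.finrank ℚ W) → ℝ) :=
    ⋂ v ∈ S.filter (fun v => 0 < u ⬝ᵥ toReal v), {r | 0 < F v r}
  have hU : IsOpen U :=
    isOpen_biInter_finset fun v _ => isOpen_lt continuous_const (hcont v)
  have hbU : (fun j => (b j : ℝ)) ∈ U := by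
    simp only [U, Set.mem_iInter]
    intro v hv
    rw [Set.mem_ofPred_eq, ← hFu]
    exact (Finset.mem_filter.mp hv).2
  have hdense : DenseRange (Pi.map (fun _ (q : ℚ) => (q : ℝ)) :
      (Fin (Module.finrank ℚ W) → ℚ) → _) :=
    DenseRange.piMap fun _ => Rat.denseRange_cast
  obtain ⟨q, hq⟩ := hdense.exists_mem_open hU ⟨_, hbU⟩
  let y : Fin n → ℚ := fun i => ∑ j, c i j * q j
  let D : ℕ := ∏ i, (y i).den
  have hD : 0 < D := Finset.prod_pos fun i _ => (y i).pos
  have hm : ∀ i, ∃ k : ℤ, (k : ℚ) = D * y i := by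
    intro i
    obtain ⟨e, he⟩ : (y i).den ∣ D := Finset.dvd_prod_of_mem _ (Finset.mem_univ i)
    refine ⟨e * (y i).num, ?_⟩
    rw [he]
    push_cast
    rw [mul_comm ((y i).den : ℚ), mul_assoc, Rat.den_mul_eq_num]
  choose m hm using hm
  have hmF : ∀ v, pairing m (toReal v) = D * F v (fun j => (q j : ℝ)) := by
    intro v
    rw [← hF, Finset.mul_sum]
    simp only [pairing, dotProduct, toReal]
    refine Finset.sum_congr rfl fun i _ => ?_
    have h1 : (m i : ℝ) = D * (∑ j, (c i j : ℝ) * (q j : ℝ)) := by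
      have := congrArg (fun z : ℚ => (z : ℝ)) (hm i)
      simpa [y] using this
    rw [h1]; ring
  refine ⟨m, fun v hv => ?_⟩
  rcases (hu v hv).eq_or_lt with h | h
  · have h0 := hzero v h.symm (fun j => (q j : ℝ))
    rw [hmF, h0, ← h]; simp
  · have h1 : 0 < F v (fun j => (q j : ℝ)) := by
      simp only [U, Set.mem_iInter] at hq
      exact hq v (Finset.mem_filter.mpr ⟨hv, h⟩)
    have h2 : 0 < pairing m (toReal v) := by
      rw [hmF]; positivity
    exact ⟨h2.le, ⟨fun h => absurd h h2.ne', fun h' => absurd h' h.ne'⟩⟩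

/-- The lattice point `m ∈ σ^∨ ∩ M` cuts out `τ` as a face of `σ`. -/
def Cuts {n : ℕ} (m : Fin n → ℤ) (τ σ : PointedCone ℝ (Fin n → ℝ)) : Prop :=
  m ∈ dualSemigroup σ ∧ ∀ v ∈ σ, (v ∈ τ ↔ pairing m v = 0)

namespace Fan

variable {n : ℕ} (F : Fan n)

lemma exists_cuts {τ σ : PointedCone ℝ (Fin n → ℝ)} (hτ : τ ∈ F.cones) (hσ : σ ∈ F.cones)
    (h : τ ≤ σ) : ∃ m, Cuts m τ σ := by
  obtain ⟨u, hu, huτ⟩ := F.inter_isFace σ hσ τ hτ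
  rw [inf_eq_right.mpr h] at huτ
  obtain ⟨S, hS⟩ := F.rational σ hσ
  have hSσ : ∀ v ∈ S, toReal v ∈ σ := fun v hv => by
    rw [hS]; exact PointedCone.subset_hull ⟨v, hv, rfl⟩
  obtain ⟨m, hm⟩ := exists_integral_form S u fun v hv => hu _ (hSσ v hv)
  have hmσ : m ∈ dualSemigroup σ := by
    intro v hv
    rw [hS] at hv
    exact nonneg_on_hull (by rintro _ ⟨v, hv, rfl⟩; exact (hm v hv).1) v hv
  -- on `σ` the two forms bound each other up to a constant
  have key : ∀ a b : Fin n → ℝ, (∀ v ∈ S, 0 ≤ a ⬝ᵥ toReal v) → (∀ v ∈ S, 0 ≤ b ⬝ᵥ toReal v) →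
      (∀ v ∈ S, a ⬝ᵥ toReal v = 0 → b ⬝ᵥ toReal v = 0) →
      ∀ v ∈ σ, a ⬝ᵥ v = 0 → b ⬝ᵥ v = 0 := by
    intro a b ha hb hab v hv hav
    obtain ⟨C, hC⟩ : ∃ C : ℝ, ∀ v ∈ S, b ⬝ᵥ toReal v ≤ C * (a ⬝ᵥ toReal v) := by
      refine ⟨∑ w ∈ S, b ⬝ᵥ toReal w / a ⬝ᵥ toReal w, fun v hv => ?_⟩
      rcases (ha v hv).eq_or_lt with h | h
      · rw [hab v hv h.symm, ← h]; simp
      · rw [← div_le_iff₀ h]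
        exact Finset.single_le_sum (f := fun w => b ⬝ᵥ toReal w / a ⬝ᵥ toReal w)
          (fun w hw => div_nonneg (hb w hw) (ha w hw)) hv
    rw [hS] at hv
    have h1 := nonneg_on_hull (u := b) (by rintro _ ⟨v, hv, rfl⟩; exact hb v hv) v hv
    have h2 := nonneg_on_hull (u := C • a - b)
      (by
        rintro _ ⟨v, hv, rfl⟩
        rw [sub_dotProduct, smul_dotProduct, smul_eq_mul]
        linarith [hC v hv]) v hv
    rw [sub_dotProduct, smul_dotProduct, hav, smul_zero] at h2
    linarith
  refine ⟨m, hmσ, fun v hv => ?_⟩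
  rw [huτ, and_iff_right hv]
  constructor
  · exact key u (toReal m) (fun v hv => hu _ (hSσ v hv)) (fun v hv => (hm v hv).1)
      (fun v hv h => (hm v hv).2.mpr h) v hv
  · exact key (toReal m) u (fun v hv => (hm v hv).1) (fun v hv => hu _ (hSσ v hv))
      (fun v hv h => (hm v hv).2.mp h) v hv

lemma isLocalization {τ σ : PointedCone ℝ (Fin n → ℝ)} (hσ : σ ∈ F.cones)
    (h : τ ≤ σ) {m : Fin n → ℤ} (hm : Cuts m τ σ) :
    let _ := (restrict h).toRingHom.toAlgebra
    IsLocalization.Away (chi (⟨m, hm.1⟩ : dualSemigroup σ)) (CoordRing τ) := by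
  let _ := (restrict h).toRingHom.toAlgebra
  have halg : ∀ x, algebraMap (CoordRing σ) (CoordRing τ) x = restrict h x := fun _ => rfl
  obtain ⟨S, hS⟩ := F.rational σ hσ
  have hSσ : ∀ v ∈ S, toReal v ∈ σ := fun v hv => by
    rw [hS]; exact PointedCone.subset_hull ⟨v, hv, rfl⟩
  have hneg : -m ∈ dualSemigroup τ := fun v hv => by
    rw [pairing_neg, ((hm.2 v (h hv)).mp hv), neg_zero]
  have hshift : ∀ w ∈ dualSemigroup τ, ∃ k : ℕ, w + k • m ∈ dualSemigroup σ := by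
    intro w hw
    refine ⟨∑ v ∈ S, (∑ i, w i * v i).natAbs, fun v hv => ?_⟩
    rw [hS] at hv
    refine nonneg_on_hull ?_ v hv
    rintro _ ⟨v, hv, rfl⟩
    change 0 ≤ pairing _ _
    rw [pairing_add, pairing_nsmul]
    by_cases h0 : pairing m (toReal v) = 0
    · rw [h0, mul_zero, add_zero]
      exact hw _ ((hm.2 _ (hSσ v hv)).mpr h0)
    · have h1 : 0 < pairing m (toReal v) := lt_of_le_of_ne (hm.1 _ (hSσ v hv)) (Ne.symm h0)
      rw [pairing_toReal] at h1 ⊢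
      rw [pairing_toReal]
      have h1' : (1 : ℤ) ≤ ∑ i, m i * v i := by exact_mod_cast h1
      have h2 : (∑ i, w i * v i).natAbs ≤ ∑ v ∈ S, (∑ i, w i * v i).natAbs :=
        Finset.single_le_sum (f := fun v => (∑ i, w i * v i : ℤ).natAbs)
          (fun _ _ => Nat.zero_le _) hv
      have h3 : -(∑ i, w i * v i : ℤ) ≤ ((∑ v ∈ S, (∑ i, w i * v i).natAbs : ℕ) : ℤ) := by
        omega
      have h4 : ((∑ v ∈ S, (∑ i, w i * v i).natAbs : ℕ) : ℤ) ≤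
          ((∑ v ∈ S, (∑ i, w i * v i).natAbs : ℕ) : ℤ) * ∑ i, m i * v i :=
        le_mul_of_one_le_right (by positivity) h1'
      generalize (∑ v ∈ S, (∑ i, w i * v i).natAbs) = K at *
      generalize (∑ i, m i * v i) = A at *
      generalize (∑ i, w i * v i) = B at *
      have : (0 : ℤ) ≤ B + (K : ℤ) * A := by linarith
      exact_mod_cast this
  have hunit : restrict h (chi ⟨m, hm.1⟩) * chi ⟨-m, hneg⟩ = 1 := by
    rw [restrict_chi, chi_mul, ← chi_zero]
    congr 1
    apply Subtype.ext
    simp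
  rw [IsLocalization.Away, isLocalization_iff]
  refine ⟨?_, ?_, ?_⟩
  · rintro ⟨_, k, rfl⟩
    simp only [map_pow, halg]
    exact (IsUnit.of_mul_eq_one _ hunit).pow k
  · intro z
    suffices ∃ (k : ℕ) (x : CoordRing σ), z * restrict h (chi ⟨m, hm.1⟩) ^ k = restrict h x by
      obtain ⟨k, x, hx⟩ := this
      exact ⟨(x, ⟨_, k, rfl⟩), by simpa [halg] using hx⟩
    induction z using AddMonoidAlgebra.induction_linear with
    | zero => exact ⟨0, 0, by simp⟩
    | add f g hf hg =>
      obtain ⟨k, x, hx⟩ := hf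
      obtain ⟨l, y, hy⟩ := hg
      refine ⟨k + l, x * chi ⟨m, hm.1⟩ ^ l + y * chi ⟨m, hm.1⟩ ^ k, ?_⟩
      rw [map_add, map_mul, map_mul, map_pow, map_pow, ← hx, ← hy]
      ring
    | single w r =>
      obtain ⟨k, hk⟩ := hshift w.1 w.2
      refine ⟨k, AddMonoidAlgebra.single ⟨w.1 + k • m, hk⟩ r, ?_⟩
      rw [restrict_chi, chi_pow, chi, AddMonoidAlgebra.single_mul_single]
      simp only [restrict, AddMonoidAlgebra.mapDomainAlgHom_apply,
        AddMonoidAlgebra.mapDomain_single, mul_one]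
      rfl
  · intro x y hxy
    exact ⟨1, by simpa using restrict_injective h hxy⟩

/-- The diagram of affine toric varieties `U_σ = Spec ℂ[σ^∨ ∩ M]`, `σ ∈ Σ`, with the inclusions
`U_τ → U_σ` for `τ ⊆ σ`. -/
def diagram : F.cones ⥤ Scheme.{0} where
  obj σ := Spec (CommRingCat.of (CoordRing σ.1))
  map {τ σ} h := Spec.map (CommRingCat.ofHom (restrict (leOfHom h)).toRingHom)
  map_id σ := by
    rw [← Spec.map_id]
    congr 1
    exact CommRingCat.hom_ext (RingHom.ext fun x => restrict_refl x)
  map_comp {ρ τ σ} h h' := by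
    rw [← Spec.map_comp]
    congr 1
    exact CommRingCat.hom_ext (RingHom.ext fun x =>
      (restrict_trans (leOfHom h') (leOfHom h) x).symm)

instance {τ σ : F.cones} (h : τ ⟶ σ) : IsOpenImmersion (F.diagram.map h) := by
  obtain ⟨m, hm⟩ := F.exists_cuts τ.2 σ.2 (leOfHom h)
  let _ := (restrict (leOfHom h)).toRingHom.toAlgebra
  have := F.isLocalization σ.2 (leOfHom h) hm
  exact IsOpenImmersion.of_isLocalization (S := CoordRing τ.1)
    (chi (⟨m, hm.1⟩ : dualSemigroup σ.1))

lemma range_diagram_map {τ σ : F.cones} (h : τ ⟶ σ) {m : Fin n → ℤ} (hm : Cuts m τ.1 σ.1)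
    (x : F.diagram.obj σ) :
    (∃ y, F.diagram.map h y = x) ↔ chi (⟨m, hm.1⟩ : dualSemigroup σ.1) ∉
      PrimeSpectrum.asIdeal (R := CoordRing σ.1) x := by
  let _ := (restrict (leOfHom h)).toRingHom.toAlgebra
  have := F.isLocalization σ.2 (leOfHom h) hm
  have := PrimeSpectrum.localization_away_comap_range (CoordRing τ.1)
    (chi (⟨m, hm.1⟩ : dualSemigroup σ.1))
  exact Set.ext_iff.mp this x

lemma inf_mem {σ τ : PointedCone ℝ (Fin n → ℝ)} (hσ : σ ∈ F.cones) (hτ : τ ∈ F.cones) :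
    σ ⊓ τ ∈ F.cones := F.face_mem σ hσ _ (F.inter_isFace σ hσ τ hτ)

instance : (F.diagram ⋙ Scheme.forget).IsLocallyDirected where
  cond {τ₁ τ₂ σ} f₁ f₂ x₁ x₂ hx := by
    obtain ⟨m₁, hm₁⟩ := F.exists_cuts τ₁.2 σ.2 (leOfHom f₁)
    obtain ⟨m₂, hm₂⟩ := F.exists_cuts τ₂.2 σ.2 (leOfHom f₂)
    let ρ : F.cones := ⟨τ₁.1 ⊓ τ₂.1, F.inf_mem τ₁.2 τ₂.2⟩
    let g₁ : ρ ⟶ τ₁ := homOfLE (inf_le_left : τ₁.1 ⊓ τ₂.1 ≤ τ₁.1)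
    let g₂ : ρ ⟶ τ₂ := homOfLE (inf_le_right : τ₁.1 ⊓ τ₂.1 ≤ τ₂.1)
    have hx' : F.diagram.map f₁ x₁ = F.diagram.map f₂ x₂ := hx
    have hm : Cuts (m₁ + m₂) ρ.1 σ.1 := by
      refine ⟨add_mem hm₁.1 hm₂.1, fun v hv => ?_⟩
      rw [pairing_add, Submodule.mem_inf, hm₁.2 v hv, hm₂.2 v hv]
      have := hm₁.1 v hv
      have := hm₂.1 v hv
      constructor
      · rintro ⟨h, h'⟩; linarith
      · intro h; constructor <;> linarith
    have h1 := (F.range_diagram_map f₁ hm₁ _).mp ⟨x₁, rfl⟩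
    have h2 := (F.range_diagram_map f₂ hm₂ _).mp ⟨x₂, rfl⟩
    rw [← hx'] at h2
    obtain ⟨y, hy⟩ := (F.range_diagram_map (g₁ ≫ f₁) hm (F.diagram.map f₁ x₁)).mpr (by
      have : (⟨m₁ + m₂, hm.1⟩ : dualSemigroup σ.1) = ⟨m₁, hm₁.1⟩ + ⟨m₂, hm₂.1⟩ := rfl
      rw [this, ← chi_mul]
      intro hmem
      exact ((PrimeSpectrum.isPrime _).mem_or_mem hmem).elim h1 h2)
    refine ⟨ρ, g₁, g₂, y, ?_, ?_⟩
    · apply (F.diagram.map f₁).isOpenEmbedding.injective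
      rw [← hy, Functor.map_comp]
      rfl
    · apply (F.diagram.map f₂).isOpenEmbedding.injective
      rw [← hx', ← hy, show g₁ ≫ f₁ = g₂ ≫ f₂ from rfl, Functor.map_comp]
      rfl

instance : Finite F.cones := F.finite

/-- The toric variety `X(Σ)` over `ℂ`: the scheme obtained by gluing the affine toric varieties
`U_σ = Spec ℂ[σ^∨ ∩ M]`, `σ ∈ Σ`, along the open subschemes `U_{σ ∩ τ}`. -/
def variety : Scheme.{0} := colimit F.diagram

/-- The inclusion of the affine chart `U_σ` in `X(Σ)`. -/
def chart (σ : F.cones) : Spec (CommRingCat.of (CoordRing σ.1)) ⟶ F.variety :=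
  colimit.ι F.diagram σ

instance (σ : F.cones) : IsOpenImmersion (F.chart σ) :=
  inferInstanceAs (IsOpenImmersion (colimit.ι F.diagram σ))

lemma exists_chart (x : F.variety) : ∃ σ y, F.chart σ y = x :=
  Scheme.IsLocallyDirected.ι_jointly_surjective F.diagram x

lemma chart_eq_iff {σ τ : F.cones} {x : Spec (CommRingCat.of (CoordRing σ.1))}
    {y : Spec (CommRingCat.of (CoordRing τ.1))} :
    F.chart σ x = F.chart τ y ↔ ∃ (ρ : F.cones) (h : ρ ≤ σ) (h' : ρ ≤ τ)
      (z : Spec (CommRingCat.of (CoordRing ρ.1))),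
      F.diagram.map (homOfLE h) z = x ∧ F.diagram.map (homOfLE h') z = y := by
  refine (Scheme.IsLocallyDirected.ι_eq_ι_iff F.diagram).trans ?_
  constructor
  · rintro ⟨ρ, f, g, z, h⟩
    exact ⟨ρ, leOfHom f, leOfHom g, z, h⟩
  · rintro ⟨ρ, f, g, z, h⟩
    exact ⟨ρ, homOfLE f, homOfLE g, z, h⟩

/-- For a subfan `Σ' ⊆ Σ`, the natural inclusion `X(Σ') → X(Σ)`, which on every chart `U_σ`,
`σ ∈ Σ'`, is the chart `U_σ` of `X(Σ)`. -/
def inclusion (G' G : Fan n) (h : G'.cones ⊆ G.cones) : G'.variety ⟶ G.variety :=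
  colimit.desc G'.diagram
    { pt := G.variety
      ι :=
        { app := fun σ => G.chart ⟨σ.1, h σ.2⟩
          naturality := fun τ σ f =>
            (colimit.w G.diagram
              (homOfLE (show (⟨τ.1, h τ.2⟩ : G.cones) ≤ ⟨σ.1, h σ.2⟩ from leOfHom f))).trans (Category.comp_id _).symm } }

lemma chart_inclusion (G' G : Fan n) (h : G'.cones ⊆ G.cones) (σ : G'.cones) :
    G'.chart σ ≫ inclusion G' G h = G.chart ⟨σ.1, h σ.2⟩ :=
  colimit.ι_desc _ σ

lemma inclusion_chart_apply (G' G : Fan n) (h : G'.cones ⊆ G.cones) (σ : G'.cones)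
    (y : Spec (CommRingCat.of (CoordRing σ.1))) :
    inclusion G' G h (G'.chart σ y) = G.chart ⟨σ.1, h σ.2⟩ y := by
  rw [← chart_inclusion G' G h σ]
  rfl

/-- `X(Σ')` is an open subvariety of `X(Σ)` for every subfan `Σ' ⊆ Σ`. -/
instance (G' G : Fan n) (h : G'.cones ⊆ G.cones) : IsOpenImmersion (inclusion G' G h) := by
  rw [IsOpenImmersion.iff_isIso_stalkMap]
  refine ⟨.of_continuous_injective_isOpenMap (inclusion G' G h).continuous ?_ ?_, ?_⟩
  · intro a b hab
    obtain ⟨σ, x, rfl⟩ := G'.exists_chart a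
    obtain ⟨τ, y, rfl⟩ := G'.exists_chart b
    rw [inclusion_chart_apply, inclusion_chart_apply, chart_eq_iff] at hab
    obtain ⟨ρ, h₁, h₂, z, hz₁, hz₂⟩ := hab
    let ρ' : G'.cones := ⟨σ.1 ⊓ τ.1, G'.inf_mem σ.2 τ.2⟩
    have hρ : ρ.1 ≤ ρ'.1 := le_inf h₁ h₂
    let ρ'' : G.cones := ⟨ρ'.1, h ρ'.2⟩
    rw [chart_eq_iff]
    refine ⟨ρ', (inf_le_left : σ.1 ⊓ τ.1 ≤ σ.1), (inf_le_right : σ.1 ⊓ τ.1 ≤ τ.1), G.diagram.map (homOfLE (show ρ ≤ ρ'' from hρ)) z, ?_, ?_⟩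
    · rw [← hz₁]
      change (G.diagram.map _ ≫ G.diagram.map
        (homOfLE (show ρ'' ≤ ⟨σ.1, h σ.2⟩ from (inf_le_left : σ.1 ⊓ τ.1 ≤ σ.1)))) z = _
      rw [← Functor.map_comp]
      rfl
    · rw [← hz₂]
      change (G.diagram.map _ ≫ G.diagram.map
        (homOfLE (show ρ'' ≤ ⟨τ.1, h τ.2⟩ from (inf_le_right : σ.1 ⊓ τ.1 ≤ τ.1)))) z = _
      rw [← Functor.map_comp]
      rfl
  · intro U hU
    have : inclusion G' G h '' U =
        ⋃ σ : G'.cones, G.chart ⟨σ.1, h σ.2⟩ '' (G'.chart σ ⁻¹' U) := by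
      ext p
      simp only [Set.mem_image, Set.mem_iUnion, Set.mem_preimage]
      constructor
      · rintro ⟨q, hq, rfl⟩
        obtain ⟨σ, x, rfl⟩ := G'.exists_chart q
        exact ⟨σ, x, hq, (inclusion_chart_apply G' G h σ x).symm⟩
      · rintro ⟨σ, x, hx, rfl⟩
        exact ⟨_, hx, inclusion_chart_apply G' G h σ x⟩
    rw [this]
    exact isOpen_iUnion fun σ => (G.chart ⟨σ.1, h σ.2⟩).isOpenEmbedding.isOpenMap _
      (hU.preimage (G'.chart σ).continuous)
  · intro a
    obtain ⟨σ, x, rfl⟩ := G'.exists_chart a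
    have h1 : IsIso ((G'.chart σ ≫ inclusion G' G h).stalkMap x) := by
      rw [chart_inclusion]
      infer_instance
    rw [Scheme.Hom.stalkMap_comp] at h1
    exact @IsIso.of_isIso_comp_right _ _ _ _ _ _ ((G'.chart σ).stalkMap x) inferInstance h1

end Fan

/-! ### Line bundles of piecewise linear functions -/

/-- An integral piecewise linear function on a fan: on every cone `σ` it is given by
`v ↦ -⟨m_σ, v⟩` for some `m_σ ∈ M`. -/
structure SupportFunction {n : ℕ} (F : Fan n) where
  toFun : (Fin n → ℝ) → ℝ
  linear : ∀ σ ∈ F.cones, ∃ m : Fin n → ℤ, ∀ v ∈ σ, toFun v = -pairing m v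

namespace SupportFunction

variable {n : ℕ} {F : Fan n} (φ : SupportFunction F)

/-- The Cartier data `m_σ` of `φ`: a lattice point with `φ = -⟨m_σ, ·⟩` on `σ`. -/
def slope (σ : F.cones) : Fin n → ℤ := (φ.linear σ.1 σ.2).choose

lemma slope_spec (σ : F.cones) : ∀ v ∈ σ.1, φ.toFun v = -pairing (φ.slope σ) v :=
  (φ.linear σ.1 σ.2).choose_spec

lemma slope_sub_mem {τ σ : F.cones} (h : τ ≤ σ) :
    φ.slope τ - φ.slope σ ∈ dualSemigroup τ.1 := by
  intro v hv
  have h1 := φ.slope_spec τ v hv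
  have h2 := φ.slope_spec σ v (h hv)
  rw [pairing_sub]
  linarith

lemma slope_sub_mem' {τ σ : F.cones} (h : τ ≤ σ) :
    φ.slope σ - φ.slope τ ∈ dualSemigroup τ.1 := by
  intro v hv
  have h1 := φ.slope_spec τ v hv
  have h2 := φ.slope_spec σ v (h hv)
  rw [pairing_sub]
  linarith

/-- The transition function `χ^{m_τ - m_σ}`, an invertible regular function on `U_τ`, `τ ⊆ σ`. -/
def transition {τ σ : F.cones} (h : τ ≤ σ) : CoordRing τ.1 :=
  chi ⟨φ.slope τ - φ.slope σ, φ.slope_sub_mem h⟩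

lemma isUnit_transition {τ σ : F.cones} (h : τ ≤ σ) : IsUnit (φ.transition h) := by
  refine IsUnit.of_mul_eq_one (chi ⟨φ.slope σ - φ.slope τ, φ.slope_sub_mem' h⟩) ?_
  rw [transition, chi_mul, ← chi_zero]
  congr 1
  apply Subtype.ext
  simp

/-- The space `Γ(X(Σ), 𝓛_φ)` of global sections of the line bundle `𝓛_φ` on `X(Σ)`. The line
bundle `𝓛_φ` is trivial on every chart `U_σ`, with generator the rational function `χ^{m_σ}`; a
global section is thus a family of regular functions `g_σ` on `U_σ` such that the rational
functions `g_σ χ^{m_σ}` agree on the overlaps, that is, `g_σ = χ^{m_τ - m_σ} g_τ` on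
`U_τ ⊆ U_σ`. -/
def GlobalSections : Submodule ℂ (∀ σ : F.cones, CoordRing σ.1) where
  carrier := {g | ∀ (τ σ : F.cones) (h : τ ≤ σ), restrict h (g σ) = φ.transition h * g τ}
  zero_mem' := fun τ σ h => by simp
  add_mem' := fun {a b} ha hb τ σ h => by
    simp only [Pi.add_apply, map_add, ha τ σ h, hb τ σ h, mul_add]
  smul_mem' := fun c a ha τ σ h => by
    simp only [Pi.smul_apply, map_smul, ha τ σ h, mul_smul_comm]

/-- The zero locus in `X(Σ)` of a global section of `𝓛_φ`: on `U_σ` it is the zero locus of the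
regular function `g_σ`. -/
def zeroLocus {φ : SupportFunction F} (g : φ.GlobalSections) : Set F.variety :=
  {x | ∃ (σ : F.cones) (y : Spec (CommRingCat.of (CoordRing σ.1))),
    F.chart σ y = x ∧ g.1 σ ∈ PrimeSpectrum.asIdeal (R := CoordRing σ.1) y}

lemma mem_asIdeal_iff {φ : SupportFunction F} (g : φ.GlobalSections) {τ σ : F.cones} (h : τ ≤ σ)
    (z : Spec (CommRingCat.of (CoordRing τ.1))) :
    g.1 σ ∈ PrimeSpectrum.asIdeal (R := CoordRing σ.1) (F.diagram.map (homOfLE h) z) ↔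
      g.1 τ ∈ PrimeSpectrum.asIdeal (R := CoordRing τ.1) z := by
  change restrict h (g.1 σ) ∈ PrimeSpectrum.asIdeal (R := CoordRing τ.1) z ↔ _
  rw [g.2 τ σ h]
  exact Ideal.unit_mul_mem_iff_mem _ (φ.isUnit_transition h)

/-- The zero locus is well defined: it can be computed in any chart. -/
lemma chart_mem_zeroLocus {φ : SupportFunction F} (g : φ.GlobalSections) (σ : F.cones)
    (y : Spec (CommRingCat.of (CoordRing σ.1))) :
    F.chart σ y ∈ zeroLocus g ↔ g.1 σ ∈ PrimeSpectrum.asIdeal (R := CoordRing σ.1) y := by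
  constructor
  · rintro ⟨τ, x, hx, hg⟩
    obtain ⟨ρ, h₁, h₂, z, rfl, rfl⟩ := F.chart_eq_iff.mp hx
    rw [mem_asIdeal_iff] at hg ⊢
    exact hg
  · exact fun h => ⟨σ, y, rfl, h⟩

/-- The Newton polytope `{u | ⟨u, v⟩ ≥ -φ(v) for all v}`. -/
def newtonPolytope : Set (Fin n → ℝ) := {u | ∀ v, -φ.toFun v ≤ u ⬝ᵥ v}

/-- The lattice points of the Newton polytope. -/
def newtonPoints : Set (Fin n → ℤ) := {m | toReal m ∈ φ.newtonPolytope}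

lemma sub_slope_mem {m : Fin n → ℤ} (hm : m ∈ φ.newtonPoints) (σ : F.cones) :
    m - φ.slope σ ∈ dualSemigroup σ.1 := by
  intro v hv
  have h1 := φ.slope_spec σ v hv
  have h2 : -φ.toFun v ≤ pairing m v := hm v
  rw [pairing_sub]
  linarith

/-- The monomial global section `z^m` of `𝓛_φ`, for `m` a lattice point of the Newton polytope:
the rational function `χ^m`, which is `χ^{m - m_σ}` in the trivialisation over `U_σ`. -/
def monomialSection (m : φ.newtonPoints) : φ.GlobalSections :=
  ⟨fun σ => chi ⟨m.1 - φ.slope σ, φ.sub_slope_mem m.2 σ⟩, fun τ σ h => by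
    rw [restrict_chi, transition, chi_mul]
    congr 1
    apply Subtype.ext
    simp⟩

end SupportFunction

/-- The torus orbit `T(σ) ⊆ U_σ ⊆ X(Σ)` of a cone `σ ∈ Σ`: the points of `U_σ` at which a
character `χ^m`, `m ∈ σ^∨ ∩ M`, is nonzero exactly if `m ∈ σ^⊥`. -/
def Fan.orbit {n : ℕ} (F : Fan n) (σ : F.cones) : Set F.variety :=
  F.chart σ '' {y | ∀ m : dualSemigroup σ.1,
    chi m ∉ PrimeSpectrum.asIdeal (R := CoordRing σ.1) y ↔ ∀ v ∈ σ.1, pairing m.1 v = 0}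

/-! ### Genericity -/

/-- The algebra of polynomial functions on a (finite-dimensional) complex vector space `W`:
the algebra of functions generated by the linear forms. -/
def polynomialFunctions (W : Type*) [AddCommGroup W] [Module ℂ W] : Subalgebra ℂ (W → ℂ) :=
  Algebra.adjoin ℂ (Set.range fun (l : Module.Dual ℂ W) (w : W) => l w)

/-- A property holds for generic elements of `W` if it holds on a nonempty Zariski open subset,
that is, wherever some nonzero polynomial function does not vanish. -/
def Generically {W : Type*} [AddCommGroup W] [Module ℂ W] (p : W → Prop) : Prop :=
  ∃ f ∈ polynomialFunctions W, f ≠ 0 ∧ ∀ w, f w ≠ 0 → p w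

/-! ### Fans over faces of polytopes -/

section polytope

variable {n : ℕ}

/-- The lattice polytope spanned by finitely many lattice points. -/
def polytope (V : Finset (Fin n → ℤ)) : Set (Fin n → ℝ) :=
  convexHull ℝ (toReal '' (V : Set (Fin n → ℤ)))

/-- Proper faces (including the empty face) of a polytope `P`, i.e. subsets of `P` other than
`P` which are empty or on which some linear form attains its maximum over `P`. -/
def IsProperFace (f P : Set (Fin n → ℝ)) : Prop := IsExposed ℝ P f ∧ f ≠ P

/-- The cones over the proper faces of a polytope; the cone over the empty face is `{0}`. -/
def faceCones (P : Set (Fin n → ℝ)) : Set (PointedCone ℝ (Fin n → ℝ)) :=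
  {σ | ∃ f, IsProperFace f P ∧ σ = PointedCone.hull ℝ f}

variable {V : Finset (Fin n → ℤ)}

lemma toReal_mem_polytope {v : Fin n → ℤ} (hv : v ∈ V) : toReal v ∈ polytope V :=
  subset_convexHull ℝ _ ⟨v, hv, rfl⟩

lemma ge_on_polytope {u : Fin n → ℝ} {c : ℝ} (h : ∀ v ∈ V, c ≤ u ⬝ᵥ toReal v) :
    ∀ x ∈ polytope V, c ≤ u ⬝ᵥ x := by
  have hconv : Convex ℝ {x : Fin n → ℝ | c ≤ u ⬝ᵥ x} :=
    convex_halfSpace_ge ⟨fun x y => dotProduct_add u x y, fun a x => by simp⟩ c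
  exact convexHull_min (by rintro _ ⟨v, hv, rfl⟩; exact h v hv) hconv

/-- The face of `polytope V` on which `u ≥ -1` attains the value `-1`. -/
def supportFace (V : Finset (Fin n → ℤ)) (u : Fin n → ℝ) : Set (Fin n → ℝ) :=
  {x ∈ polytope V | u ⬝ᵥ x = -1}

lemma supportFace_subset_hull {u : Fin n → ℝ} (hu : ∀ v ∈ V, -1 ≤ u ⬝ᵥ toReal v) :
    supportFace V u ⊆ convexHull ℝ (toReal '' {v | v ∈ V ∧ u ⬝ᵥ toReal v = -1}) := by
  classical
  rintro x ⟨hx, hux⟩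
  have hx' : x ∈ convexHull ℝ ((V.image toReal : Finset (Fin n → ℝ)) : Set (Fin n → ℝ)) := by
    simpa [polytope] using hx
  rw [Finset.mem_convexHull'] at hx'
  obtain ⟨w, hw0, hw1, hwx⟩ := hx'
  have h1 : ∑ y ∈ V.image toReal, w y * (u ⬝ᵥ y + 1) = 0 := by
    simp only [mul_add, mul_one, Finset.sum_add_distrib, hw1]
    have : ∑ y ∈ V.image toReal, w y * (u ⬝ᵥ y) = u ⬝ᵥ x := by
      rw [← hwx, dotProduct_sum]
      exact Finset.sum_congr rfl fun y _ => by rw [dotProduct_smul, smul_eq_mul]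
    rw [this, hux]; norm_num
  have h2 : ∀ y ∈ V.image toReal, w y * (u ⬝ᵥ y + 1) = 0 := by
    refine (Finset.sum_eq_zero_iff_of_nonneg fun y hy => ?_).mp h1
    obtain ⟨v, hv, rfl⟩ := Finset.mem_image.mp hy
    exact mul_nonneg (hw0 _ hy) (by linarith [hu v hv])
  rw [← hwx, ← Finset.sum_filter_add_sum_filter_not _ (fun y => w y = 0)]
  rw [Finset.sum_eq_zero (s := Finset.filter (fun y => w y = 0) _) (fun y hy => by
    rw [(Finset.mem_filter.mp hy).2, zero_smul]), zero_add]
  refine (convex_convexHull ℝ _).sum_mem (fun y hy => hw0 y (Finset.mem_filter.mp hy).1) ?_ ?_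
  · rw [← hw1, ← Finset.sum_filter_add_sum_filter_not (V.image toReal) (fun y => w y = 0)]
    rw [Finset.sum_eq_zero (s := Finset.filter (fun y => w y = 0) _) (fun y hy =>
      (Finset.mem_filter.mp hy).2), zero_add]
  · intro y hy
    obtain ⟨hy1, hy2⟩ := Finset.mem_filter.mp hy
    obtain ⟨v, hv, rfl⟩ := Finset.mem_image.mp hy1
    refine subset_convexHull ℝ _ ⟨v, ⟨hv, ?_⟩, rfl⟩
    rcases mul_eq_zero.mp (h2 _ hy1) with h | h
    · exact absurd h hy2
    · linarith

lemma hull_supportFace {u : Fin n → ℝ} (hu : ∀ v ∈ V, -1 ≤ u ⬝ᵥ toReal v) :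
    PointedCone.hull ℝ (supportFace V u) =
      PointedCone.hull ℝ (toReal '' {v | v ∈ V ∧ u ⬝ᵥ toReal v = -1}) := by
  apply le_antisymm
  · refine Submodule.span_le.mpr ((supportFace_subset_hull hu).trans ?_)
    exact convexHull_min PointedCone.subset_hull (PointedCone.convex _)
  · refine Submodule.span_mono ?_
    rintro _ ⟨v, ⟨hv, huv⟩, rfl⟩
    exact ⟨toReal_mem_polytope hv, huv⟩

lemma convex_supportFace (u : Fin n → ℝ) : Convex ℝ (supportFace V u) :=
  (convex_convexHull ℝ _).inter
    (convex_hyperplane ⟨fun x y => dotProduct_add u x y, fun a x => by simp⟩ (-1))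

/-- The cone over a convex set consists of the nonnegative multiples of its points. -/
lemma mem_hull_convex {f : Set (Fin n → ℝ)} (hf : Convex ℝ f) {x : Fin n → ℝ}
    (hx : x ∈ PointedCone.hull ℝ f) : x = 0 ∨ ∃ t : ℝ, 0 < t ∧ ∃ p ∈ f, x = t • p := by
  induction hx using Submodule.span_induction with
  | mem x hx => exact .inr ⟨1, one_pos, x, hx, (one_smul _ _).symm⟩
  | zero => exact .inl rfl
  | add x y _ _ hx hy =>
    rcases hx with rfl | ⟨t, ht, p, hp, rfl⟩
    · simpa using hy
    rcases hy with rfl | ⟨s, hs, q, hq, rfl⟩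
    · exact .inr ⟨t, ht, p, hp, by simp⟩
    refine .inr ⟨t + s, by positivity, (t / (t + s)) • p + (s / (t + s)) • q,
      hf hp hq (by positivity) (by positivity) (by field_simp), ?_⟩
    rw [smul_add, smul_smul, smul_smul]
    congr 2 <;> field_simp
  | smul a x _ hx =>
    have h : a • x = (a : ℝ) • x := rfl
    rw [h]
    rcases hx with rfl | ⟨t, ht, p, hp, rfl⟩
    · simp
    rcases a.2.eq_or_lt with ha | ha
    · left; rw [← ha, zero_smul]
    · exact .inr ⟨a * t, by positivity, p, hp, by rw [smul_smul]⟩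

lemma isProperFace_supportFace (h0 : (0 : Fin n → ℝ) ∈ polytope V) {u : Fin n → ℝ}
    (hu : ∀ v ∈ V, -1 ≤ u ⬝ᵥ toReal v) : IsProperFace (supportFace V u) (polytope V) := by
  constructor
  · rintro ⟨p, hp⟩
    refine ⟨LinearMap.toContinuousLinearMap (-(dotProductBilin ℝ ℝ u)), ?_⟩
    ext x
    have hle := ge_on_polytope hu
    simp only [supportFace, Set.mem_ofPred_eq, LinearMap.coe_toContinuousLinearMap',
      LinearMap.neg_apply, dotProductBilin_apply_apply, neg_le_neg_iff]
    refine and_congr_right fun hx => ⟨fun h y hy => h ▸ hle y hy, fun h => ?_⟩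
    exact le_antisymm (hp.2 ▸ h p hp.1) (hle x hx)
  · intro h
    rw [← h] at h0
    have := h0.2
    simp at this

lemma exists_supportFace (h0 : (0 : Fin n → ℝ) ∈ interior (polytope V)) {f : Set (Fin n → ℝ)}
    (hf : IsProperFace f (polytope V)) :
    ∃ u : Fin n → ℝ, (∀ v ∈ V, -1 ≤ u ⬝ᵥ toReal v) ∧ f = supportFace V u := by
  rcases f.eq_empty_or_nonempty with rfl | hne
  · exact ⟨0, by simp, by ext; simp [supportFace]⟩
  obtain ⟨l, hl⟩ := hf.1 hne
  obtain ⟨p, hp⟩ := hne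
  have hp' := hp
  rw [hl] at hp'
  let c : Fin n → ℝ := fun i => l (Pi.single i 1)
  have hlc : ∀ x, l x = c ⬝ᵥ x := by
    intro x
    conv_lhs => rw [← Finset.univ_sum_single x, map_sum]
    refine Finset.sum_congr rfl fun i _ => ?_
    have : Pi.single i (x i) = x i • (Pi.single i 1 : Fin n → ℝ) := by
      rw [← Pi.single_smul]; simp
    rw [this, map_smul, smul_eq_mul, mul_comm]
  have h0P : (0 : Fin n → ℝ) ∈ polytope V := interior_subset h0
  have hM0 : 0 ≤ l p := by simpa using hp'.2 0 h0P
  have hM : 0 < l p := by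
    refine lt_of_le_of_ne hM0 fun hM => hf.2 ?_
    have hloc : ∀ x, l x ≤ 0 := by
      intro x
      have hcont : Filter.Tendsto (fun t : ℝ => t • x) (nhdsWithin 0 (Set.Ioi 0))
          (nhds (0 : Fin n → ℝ)) := by
        have : Continuous fun t : ℝ => t • x := by fun_prop
        simpa using (this.tendsto 0).mono_left nhdsWithin_le_nhds
      have hev := hcont.eventually (mem_interior_iff_mem_nhds.mp h0)
      obtain ⟨t, ht, htpos⟩ := (hev.and self_mem_nhdsWithin).exists
      have := hp'.2 _ ht
      rw [map_smul, smul_eq_mul, ← hM] at this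
      by_contra hx
      push Not at hx
      exact absurd this (not_le.mpr (mul_pos htpos hx))
    have hz : ∀ x, l x = 0 := fun x =>
      le_antisymm (hloc x) (by have := hloc (-x); rw [map_neg] at this; linarith)
    rw [hl]
    ext x
    simp [hz]
  refine ⟨-(l p)⁻¹ • c, fun v hv => ?_, ?_⟩
  · rw [smul_dotProduct, ← hlc, smul_eq_mul, neg_mul, neg_le_neg_iff, inv_mul_le_iff₀ hM, mul_one]
    exact hp'.2 _ (toReal_mem_polytope hv)
  · rw [hl]
    ext x
    simp only [supportFace, Set.mem_ofPred_eq, smul_dotProduct, ← hlc, smul_eq_mul, neg_mul,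
      neg_inj]
    refine and_congr_right fun hx => ?_
    rw [inv_mul_eq_one₀ hM.ne']
    exact ⟨fun h => le_antisymm (h p hp'.1) (hp'.2 x hx), fun h y hy => h ▸ hp'.2 y hy⟩

/-- The dot product with `u` is negative on the cone over `supportFace V u`, except at `0`. -/
lemma mem_hull_supportFace {u x : Fin n → ℝ}
    (hx : x ∈ PointedCone.hull ℝ (supportFace V u)) :
    x = 0 ∨ ∃ t : ℝ, 0 < t ∧ u ⬝ᵥ x = -t ∧ ∃ p ∈ supportFace V u, x = t • p := by
  rcases mem_hull_convex (convex_supportFace u) hx with h | ⟨t, ht, p, hp, rfl⟩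
  · exact .inl h
  · exact .inr ⟨t, ht, by rw [dotProduct_smul, hp.2]; simp, p, hp, rfl⟩

lemma smul_mem_hull {f : Set (Fin n → ℝ)} {p : Fin n → ℝ} (hp : p ∈ f) {t : ℝ} (ht : 0 ≤ t) :
    t • p ∈ PointedCone.hull ℝ f :=
  PointedCone.smul_mem _ ht (PointedCone.subset_hull hp)

lemma face_supportFace {u : Fin n → ℝ}
    (hu : ∀ v ∈ V, -1 ≤ u ⬝ᵥ toReal v) {τ : PointedCone ℝ (Fin n → ℝ)}
    (hτ : IsFace τ (PointedCone.hull ℝ (supportFace V u))) :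
    ∃ w : Fin n → ℝ, (∀ v ∈ V, -1 ≤ w ⬝ᵥ toReal v) ∧ supportFace V w ⊆ supportFace V u ∧
      τ = PointedCone.hull ℝ (supportFace V w) := by
  obtain ⟨a, ha, haτ⟩ := hτ
  obtain ⟨ε, hε, hεpos⟩ : ∃ ε : ℝ, (∀ v ∈ V, -1 < u ⬝ᵥ toReal v →
      -1 < u ⬝ᵥ toReal v + ε * (a ⬝ᵥ toReal v)) ∧ 0 < ε := by
    have : ∀ᶠ ε in nhdsWithin (0 : ℝ) (Set.Ioi 0), ∀ v ∈ V, -1 < u ⬝ᵥ toReal v →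
        -1 < u ⬝ᵥ toReal v + ε * (a ⬝ᵥ toReal v) := by
      rw [Filter.eventually_all_finset]
      intro v _
      by_cases h : -1 < u ⬝ᵥ toReal v
      · have hc : Continuous fun ε : ℝ => u ⬝ᵥ toReal v + ε * (a ⬝ᵥ toReal v) := by fun_prop
        have := (hc.tendsto 0).mono_left (nhdsWithin_le_nhds (s := Set.Ioi (0 : ℝ)))
        filter_upwards [this.eventually (lt_mem_nhds (by simpa using h))] with ε hε _ using hε
      · filter_upwards with ε h' using absurd h' h
    exact (this.and self_mem_nhdsWithin).exists
  have hav : ∀ v ∈ V, u ⬝ᵥ toReal v = -1 → 0 ≤ a ⬝ᵥ toReal v := fun v hv h =>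
    ha _ (PointedCone.subset_hull ⟨toReal_mem_polytope hv, h⟩)
  let w := u + ε • a
  have hwx : ∀ x, w ⬝ᵥ x = u ⬝ᵥ x + ε * (a ⬝ᵥ x) := fun x => by
    simp only [w, add_dotProduct, smul_dotProduct, smul_eq_mul]
  have hw : ∀ v ∈ V, -1 ≤ w ⬝ᵥ toReal v := by
    intro v hv
    rw [hwx]
    rcases (hu v hv).eq_or_lt with h | h
    · have := mul_nonneg hεpos.le (hav v hv h.symm)
      linarith
    · exact (hε v hv h).le
  have hsub : ∀ p ∈ supportFace V w, u ⬝ᵥ p = -1 ∧ a ⬝ᵥ p = 0 := by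
    intro p hp
    have hp1 := supportFace_subset_hull hw hp
    have hconv : Convex ℝ ({x : Fin n → ℝ | u ⬝ᵥ x = -1} ∩ {x : Fin n → ℝ | a ⬝ᵥ x = 0}) :=
      (convex_hyperplane ⟨fun x y => dotProduct_add u x y, fun a x => by simp⟩ _).inter
        (convex_hyperplane ⟨fun x y => dotProduct_add a x y, fun a x => by simp⟩ _)
    refine convexHull_min ?_ hconv hp1
    rintro _ ⟨v, ⟨hv, hwv⟩, rfl⟩
    rw [hwx] at hwv
    rcases (hu v hv).eq_or_lt with h | h
    · refine ⟨h.symm, ?_⟩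
      rw [← h] at hwv
      have : ε * (a ⬝ᵥ toReal v) = 0 := by linarith
      exact (mul_eq_zero.mp this).resolve_left hεpos.ne'
    · exact absurd hwv (hε v hv h).ne'
  refine ⟨w, hw, fun p hp => ⟨hp.1, (hsub p hp).1⟩, ?_⟩
  ext x
  rw [haτ]
  constructor
  · rintro ⟨hx, hax⟩
    rcases mem_hull_supportFace hx with rfl | ⟨t, ht, -, p, hp, rfl⟩
    · exact zero_mem _
    · rw [dotProduct_smul, smul_eq_mul] at hax
      have hap := (mul_eq_zero.mp hax).resolve_left ht.ne'
      have hpw : p ∈ supportFace V w := ⟨hp.1, by rw [hwx, hp.2, hap]; simp⟩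
      exact smul_mem_hull hpw ht.le
  · intro hx
    rcases mem_hull_supportFace hx with rfl | ⟨t, ht, -, p, hp, rfl⟩
    · exact ⟨zero_mem _, by simp⟩
    · have hpu : p ∈ supportFace V u := ⟨hp.1, (hsub p hp).1⟩
      exact ⟨smul_mem_hull hpu ht.le, by
        rw [dotProduct_smul, (hsub p hp).2, smul_zero]⟩

lemma inter_supportFace {u w : Fin n → ℝ}
    (hu : ∀ v ∈ V, -1 ≤ u ⬝ᵥ toReal v) (hw : ∀ v ∈ V, -1 ≤ w ⬝ᵥ toReal v) :
    IsFace (PointedCone.hull ℝ (supportFace V u) ⊓ PointedCone.hull ℝ (supportFace V w))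
      (PointedCone.hull ℝ (supportFace V u)) := by
  refine ⟨w - u, ?_, fun x => ?_⟩
  · refine nonneg_on_hull fun p hp => ?_
    rw [sub_dotProduct, hp.2]
    linarith [ge_on_polytope hw p hp.1]
  · rw [Submodule.mem_inf]
    refine and_congr_right fun hx => ?_
    rcases mem_hull_supportFace hx with rfl | ⟨t, ht, hux, p, hp, rfl⟩
    · simp
    · constructor
      · intro hx'
        rcases mem_hull_supportFace hx' with h | ⟨s, hs, hwx, q, hq, hpq⟩
        · rw [h]; simp
        · have h1 : -t ≤ w ⬝ᵥ (t • p) := by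
            rw [dotProduct_smul, smul_eq_mul]
            nlinarith [ge_on_polytope hw p hp.1]
          have h2 : -s ≤ u ⬝ᵥ (t • p) := by
            rw [hpq, dotProduct_smul, smul_eq_mul]
            nlinarith [ge_on_polytope hu q hq.1]
          rw [sub_dotProduct]
          linarith
      · intro h
        rw [sub_dotProduct, dotProduct_smul, dotProduct_smul, hp.2, smul_eq_mul, smul_eq_mul] at h
        have : w ⬝ᵥ p = -1 := by
          have : t * (w ⬝ᵥ p + 1) = 0 := by linarith
          linarith [(mul_eq_zero.mp this).resolve_left ht.ne']
        have hpw : p ∈ supportFace V w := ⟨hp.1, this⟩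
        exact smul_mem_hull hpw ht.le

/-- The fan `Σ(P)` of cones over the proper faces of a lattice polytope `P` with the origin in its
interior. -/
def faceFan (V : Finset (Fin n → ℤ)) (h0 : (0 : Fin n → ℝ) ∈ interior (polytope V)) : Fan n where
  cones := faceCones (polytope V)
  finite := by
    refine ((V.finite_toSet.finite_subsets).image
      fun S => PointedCone.hull ℝ (toReal '' S)).subset ?_
    rintro σ ⟨f, hf, rfl⟩
    obtain ⟨u, hu, rfl⟩ := exists_supportFace h0 hf
    have hS : {v | v ∈ V ∧ u ⬝ᵥ toReal v = -1} ⊆ (V : Set (Fin n → ℤ)) := fun v hv => hv.1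
    exact ⟨_, hS, (hull_supportFace hu).symm⟩
  nonempty := by
    refine ⟨_, ∅, ⟨isExposed_empty, fun h => ?_⟩, rfl⟩
    have h0' := interior_subset h0
    rw [← h] at h0'
    exact h0'
  rational := by
    classical
    rintro σ ⟨f, hf, rfl⟩
    obtain ⟨u, hu, rfl⟩ := exists_supportFace h0 hf
    refine ⟨V.filter fun v => u ⬝ᵥ toReal v = -1, ?_⟩
    rw [hull_supportFace hu, Finset.coe_filter]
  salient := by
    rintro σ ⟨f, hf, rfl⟩ x hx hx'
    obtain ⟨u, hu, rfl⟩ := exists_supportFace h0 hf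
    rcases mem_hull_supportFace hx with h | ⟨t, ht, h1, -⟩
    · exact h
    rcases mem_hull_supportFace hx' with h | ⟨s, hs, h2, -⟩
    · exact neg_eq_zero.mp h
    rw [dotProduct_neg] at h2
    linarith
  face_mem := by
    rintro σ ⟨f, hf, rfl⟩ τ hτ
    obtain ⟨u, hu, rfl⟩ := exists_supportFace h0 hf
    obtain ⟨w, hw, hwu, rfl⟩ := face_supportFace hu hτ
    exact ⟨_, isProperFace_supportFace (interior_subset h0) hw, rfl⟩
  inter_isFace := by
    rintro σ ⟨f, hf, rfl⟩ τ ⟨g, hg, rfl⟩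
    obtain ⟨u, hu, rfl⟩ := exists_supportFace h0 hf
    obtain ⟨w, hw, rfl⟩ := exists_supportFace h0 hg
    exact inter_supportFace hu hw

end polytope

/-- A nonempty set of cones of a fan, closed under taking faces, is a fan (a subfan). -/
def Fan.subfan {n : ℕ} (F : Fan n) (C : Set (PointedCone ℝ (Fin n → ℝ))) (hC : C ⊆ F.cones)
    (hne : C.Nonempty) (hface : ∀ σ ∈ C, ∀ τ, IsFace τ σ → τ ∈ C) : Fan n where
  cones := C
  finite := F.finite.subset hC
  nonempty := hne
  rational σ hσ := F.rational σ (hC hσ)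
  salient σ hσ := F.salient σ (hC hσ)
  face_mem := hface
  inter_isFace σ hσ τ hτ := F.inter_isFace σ (hC hσ) τ (hC hτ)

/-- Two integral piecewise linear functions on `Σ(P)` with the same values at the vertices of `P`
agree on all cones of `Σ(P)`. -/
lemma SupportFunction.eqOn_of_vertices {n : ℕ} {V : Finset (Fin n → ℤ)}
    {h0 : (0 : Fin n → ℝ) ∈ interior (polytope V)} (φ ψ : SupportFunction (faceFan V h0))
    (h : ∀ v ∈ V, φ.toFun (toReal v) = ψ.toFun (toReal v)) :
    ∀ σ ∈ (faceFan V h0).cones, ∀ x ∈ σ, φ.toFun x = ψ.toFun x := by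
  intro σ hσ x hx
  obtain ⟨a, ha⟩ := φ.linear σ hσ
  obtain ⟨b, hb⟩ := ψ.linear σ hσ
  rw [ha x hx, hb x hx, neg_inj]
  obtain ⟨f, hf, rfl⟩ := hσ
  obtain ⟨u, hu, rfl⟩ := exists_supportFace h0 hf
  have hV : ∀ v ∈ V, u ⬝ᵥ toReal v = -1 →
      toReal v ∈ PointedCone.hull ℝ (supportFace V u) := fun v hv hv' =>
    PointedCone.subset_hull ⟨toReal_mem_polytope hv, hv'⟩
  rw [hull_supportFace hu] at hx
  refine eq_on_hull ?_ x hx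
  rintro _ ⟨v, ⟨hv, huv⟩, rfl⟩
  have h1 := ha _ (hV v hv huv)
  have h2 := hb _ (hV v hv huv)
  have h3 := h v hv
  change pairing a _ = pairing b _
  linarith

/-! ### The polytope `∇` and its line bundles -/

/-- The vertices of `∇₁`. -/
def nablaVertices₁ : Finset (Fin 5 → ℤ) :=
  {![-1, -1, -1, -1, 0], ![3, -1, -1, -1, 0], ![-1, 3, -1, -1, 0], ![-1, -1, 3, -1, 0],
    ![-1, -1, -1, 3, 0], ![-1, -1, -1, -1, 4]}

/-- The vertices of `∇₂`. -/
def nablaVertices₂ : Finset (Fin 5 → ℤ) :=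
  {![0, 0, 0, 0, -1], ![2, 0, 0, 0, -1], ![0, 2, 0, 0, -1], ![0, 0, 2, 0, -1],
    ![0, 0, 0, 2, -1], ![0, 0, 0, 0, 1]}

/-- The vertices of `∇ = Conv(∇₁, ∇₂)`. -/
def nablaVertices : Finset (Fin 5 → ℤ) := nablaVertices₁ ∪ nablaVertices₂

/-- The polytope `∇ ⊆ N'_ℝ = ℝ⁵`. -/
def nabla : Set (Fin 5 → ℝ) := polytope nablaVertices

lemma forall_nablaVertices {p : (Fin 5 → ℤ) → Prop} :
    (∀ v ∈ nablaVertices, p v) ↔ (∀ v ∈ nablaVertices₁, p v) ∧ ∀ v ∈ nablaVertices₂, p v := by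
  simp only [nablaVertices, Finset.mem_union, or_imp, forall_and]

lemma zero_mem_interior_nabla : (0 : Fin 5 → ℝ) ∈ interior (polytope nablaVertices) := by
  rw [mem_interior_iff_mem_nhds, Metric.mem_nhds_iff]
  refine ⟨1 / 20, by norm_num, fun x hx => ?_⟩
  have hx' : ∀ i, |x i| < 1 / 20 := fun i => by
    have := (pi_norm_lt_iff (by norm_num)).mp (mem_ball_zero_iff.mp hx) i
    simpa using this
  have h0 := abs_lt.mp (hx' 0)
  have h1 := abs_lt.mp (hx' 1)
  have h2 := abs_lt.mp (hx' 2)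
  have h3 := abs_lt.mp (hx' 3)
  have h4 := abs_lt.mp (hx' 4)
  let β : ℝ := (1 + x 4) / 5
  let p : Fin 6 → (Fin 5 → ℤ) := ![![2, 0, 0, 0, -1], ![0, 2, 0, 0, -1], ![0, 0, 2, 0, -1],
    ![0, 0, 0, 2, -1], ![-1, -1, -1, -1, 4], ![0, 0, 0, 0, -1]]
  let w : Fin 6 → ℝ := ![(x 0 + β) / 2, (x 1 + β) / 2, (x 2 + β) / 2, (x 3 + β) / 2, β,
    1 - (x 0 + x 1 + x 2 + x 3 + 4 * β) / 2 - β]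
  have hp : ∀ k, p k ∈ nablaVertices := by decide
  have hw0 : ∀ k, 0 ≤ w k := by
    intro k
    fin_cases k <;> simp [w, β] <;> linarith
  have hw1 : ∑ k, w k = 1 := by
    simp [w, Fin.sum_univ_succ]
    ring
  have hx : x = ∑ k, w k • toReal (p k) := by
    ext i
    simp only [Finset.sum_apply, Pi.smul_apply, smul_eq_mul, Fin.sum_univ_succ]
    fin_cases i <;> simp [w, p, toReal, β] <;> ring
  rw [hx]
  exact (convex_convexHull ℝ _).sum_mem (fun k _ => hw0 k) hw1
    fun k _ => toReal_mem_polytope (hp k)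

/-- The fan `Σ(∇)` of cones over the proper faces of `∇`. -/
def nablaFan : Fan 5 := faceFan nablaVertices zero_mem_interior_nabla

/-- The conditions on a face `f` of `∇` in the definition of `Σ'(∇)`. -/
def IsAllowedFace (f : Set (Fin 5 → ℝ)) : Prop :=
  ![0, 0, 0, 0, -1] ∉ f ∧ ![0, 0, 0, 0, 1] ∉ f ∧
    ¬ segment ℝ ![-1, -1, -1, -1, 0] ![-1, -1, -1, -1, 4] ⊆ f

/-- The subfan `Σ'(∇)` of `Σ(∇)`, consisting of the cones over the faces `f` of `∇` which contain
neither `(0,0,0,0,-1)`, nor `(0,0,0,0,1)`, nor the segment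
`Conv((-1,-1,-1,-1,0), (-1,-1,-1,-1,4))`. -/
def nablaSubfan : Fan 5 :=
  nablaFan.subfan {σ | ∃ f, IsProperFace f nabla ∧ IsAllowedFace f ∧ σ = PointedCone.hull ℝ f}
    (by rintro σ ⟨f, hf, -, rfl⟩; exact ⟨f, hf, rfl⟩)
    (by
      refine ⟨_, ∅, ⟨isExposed_empty, fun h => ?_⟩, ⟨id, id, fun h => ?_⟩, rfl⟩
      · have h0 := interior_subset zero_mem_interior_nabla
        change _ ∈ nabla at h0
        rw [← h] at h0
        exact h0
      · exact h (left_mem_segment ℝ _ _))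
    (by
      rintro σ ⟨f, hf, hfA, rfl⟩ τ hτ
      obtain ⟨u, hu, rfl⟩ := exists_supportFace zero_mem_interior_nabla hf
      obtain ⟨w, hw, hwu, rfl⟩ := face_supportFace hu hτ
      exact ⟨_, isProperFace_supportFace (interior_subset zero_mem_interior_nabla) hw,
        ⟨fun h => hfA.1 (hwu h), fun h => hfA.2.1 (hwu h), fun h => hfA.2.2 (h.trans hwu)⟩, rfl⟩)

lemma nablaSubfan_subset : nablaSubfan.cones ⊆ nablaFan.cones := by
  rintro σ ⟨f, hf, -, rfl⟩
  exact ⟨f, hf, rfl⟩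

/-- The function `φ¹` on `N'_ℝ`. -/
def phi₁ (x : Fin 5 → ℝ) : ℝ := max 0 (max (-x 0) (max (-x 1) (max (-x 2) (-x 3))))

/-- The function `φ²` on `N'_ℝ`. -/
def phi₂ (x : Fin 5 → ℝ) : ℝ := max 0 (max (-x 4) (x 0 + x 1 + x 2 + x 3 + x 4))

lemma phi₁_vertices₁ : ∀ v ∈ nablaVertices₁, phi₁ (toReal v) = 1 := by
  simp only [nablaVertices₁, Finset.forall_mem_insert, Finset.mem_singleton, forall_eq]
  refine ⟨?_, ?_, ?_, ?_, ?_, ?_⟩ <;> simp [phi₁, toReal] <;> norm_num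

lemma phi₁_vertices₂ : ∀ v ∈ nablaVertices₂, phi₁ (toReal v) = 0 := by
  simp only [nablaVertices₂, Finset.forall_mem_insert, Finset.mem_singleton, forall_eq]
  refine ⟨?_, ?_, ?_, ?_, ?_, ?_⟩ <;> simp [phi₁, toReal] <;> norm_num

lemma phi₂_vertices₁ : ∀ v ∈ nablaVertices₁, phi₂ (toReal v) = 0 := by
  simp only [nablaVertices₁, Finset.forall_mem_insert, Finset.mem_singleton, forall_eq]
  refine ⟨?_, ?_, ?_, ?_, ?_, ?_⟩ <;> simp [phi₂, toReal] <;> norm_num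

lemma phi₂_vertices₂ : ∀ v ∈ nablaVertices₂, phi₂ (toReal v) = 1 := by
  simp only [nablaVertices₂, Finset.forall_mem_insert, Finset.mem_singleton, forall_eq]
  refine ⟨?_, ?_, ?_, ?_, ?_, ?_⟩ <;> simp [phi₂, toReal] <;> norm_num

/-- The slopes of `phi₁`. -/
def slopes₁ : Fin 5 → (Fin 5 → ℤ) :=
  ![0, ![1, 0, 0, 0, 0], ![0, 1, 0, 0, 0], ![0, 0, 1, 0, 0], ![0, 0, 0, 1, 0]]

/-- The slopes of `phi₂`. -/
def slopes₂ : Fin 3 → (Fin 5 → ℤ) := ![0, ![0, 0, 0, 0, 1], ![-1, -1, -1, -1, -1]]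

lemma le_phi₁ (x : Fin 5 → ℝ) (k : Fin 5) : -pairing (slopes₁ k) x ≤ phi₁ x := by
  fin_cases k <;>
    simp [slopes₁, pairing, toReal, dotProduct, Fin.sum_univ_five, phi₁]

lemma le_phi₂ (x : Fin 5 → ℝ) (k : Fin 3) : -pairing (slopes₂ k) x ≤ phi₂ x := by
  fin_cases k <;>
    simp [slopes₂, pairing, toReal, dotProduct, Fin.sum_univ_five, phi₂]
  right; right; linarith

lemma phi₁_le {x : Fin 5 → ℝ} {c : ℝ} (h : ∀ k, -pairing (slopes₁ k) x ≤ c) : phi₁ x ≤ c := by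
  have h0 := h 0
  have h1 := h 1
  have h2 := h 2
  have h3 := h 3
  have h4 := h 4
  simp [slopes₁, pairing, toReal, dotProduct, Fin.sum_univ_five] at h0 h1 h2 h3 h4
  simp only [phi₁, max_le_iff]
  exact ⟨h0, by linarith, by linarith, by linarith, by linarith⟩

lemma phi₂_le {x : Fin 5 → ℝ} {c : ℝ} (h : ∀ k, -pairing (slopes₂ k) x ≤ c) : phi₂ x ≤ c := by
  have h0 := h 0
  have h1 := h 1
  have h2 := h 2
  simp [slopes₂, pairing, toReal, dotProduct, Fin.sum_univ_five] at h0 h1 h2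
  simp only [phi₂, max_le_iff]
  exact ⟨h0, by linarith, by linarith⟩

/-- Every `u` which is at least `-1` on `∇` is the sum of a convex combination of the slopes of
`phi₁` and a convex combination of the slopes of `phi₂`. -/
lemma exists_weights {u : Fin 5 → ℝ} (hu : ∀ v ∈ nablaVertices, -1 ≤ u ⬝ᵥ toReal v) :
    ∃ (a : Fin 5 → ℝ) (b : Fin 3 → ℝ), (∀ k, 0 ≤ a k) ∧ (∀ k, 0 ≤ b k) ∧ ∑ k, a k = 1 ∧
      ∑ k, b k = 1 ∧ ∀ x, u ⬝ᵥ x =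
        ∑ k, a k * pairing (slopes₁ k) x + ∑ k, b k * pairing (slopes₂ k) x := by
  rw [forall_nablaVertices] at hu
  simp only [nablaVertices₁, nablaVertices₂, Finset.forall_mem_insert, Finset.mem_singleton,
    forall_eq] at hu
  simp [dotProduct, toReal, Fin.sum_univ_five] at hu
  obtain ⟨⟨p1, p2, p3, p4, p5, p6⟩, q1, q2, q3, q4, q5, q6⟩ := hu
  obtain ⟨c, hc⟩ : ∃ c, c = max 0 (max (-u 0) (max (-u 1) (max (-u 2) (max (-u 3) (-u 4))))) :=
    ⟨_, rfl⟩
  have hle : max 0 (max (-u 0) (max (-u 1) (max (-u 2) (max (-u 3) (-u 4))))) ≤ c := hc.ge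
  simp only [max_le_iff] at hle
  obtain ⟨l0, l1, l2, l3, l4, l5⟩ := hle
  have hcases : c = 0 ∨ c = -u 0 ∨ c = -u 1 ∨ c = -u 2 ∨ c = -u 3 ∨ c = -u 4 := by
    rw [hc]
    grind
  have hA : u 0 + u 1 + u 2 + u 3 + 4 * c ≤ 1 := by
    rcases hcases with h | h | h | h | h | h <;> rw [h] <;> linarith
  have hB : u 4 + 2 * c ≤ 1 := by
    rcases hcases with h | h | h | h | h | h <;> rw [h] <;> linarith
  refine ⟨![1 - (u 0 + u 1 + u 2 + u 3 + 4 * c), u 0 + c, u 1 + c, u 2 + c, u 3 + c],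
    ![1 - (u 4 + 2 * c), u 4 + c, c], ?_, ?_, ?_, ?_, ?_⟩
  · intro k; fin_cases k <;> simp <;> linarith
  · intro k; fin_cases k <;> simp <;> linarith
  · simp [Fin.sum_univ_five]; ring
  · simp [Fin.sum_univ_three]; ring
  · intro x
    simp [Fin.sum_univ_five, Fin.sum_univ_three, slopes₁, slopes₂, pairing, toReal, dotProduct]
    ring

lemma phi_linear {u : Fin 5 → ℝ} (hu : ∀ v ∈ nablaVertices, -1 ≤ u ⬝ᵥ toReal v) :
    (∃ m : Fin 5 → ℤ, ∀ x ∈ PointedCone.hull ℝ (supportFace nablaVertices u),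
      phi₁ x = -pairing m x) ∧
    ∃ m : Fin 5 → ℤ, ∀ x ∈ PointedCone.hull ℝ (supportFace nablaVertices u),
      phi₂ x = -pairing m x := by
  obtain ⟨a, b, ha, hb, ha1, hb1, hab⟩ := exists_weights hu
  have hone : ∀ v ∈ nablaVertices, phi₁ (toReal v) + phi₂ (toReal v) = 1 := by
    rw [forall_nablaVertices]
    exact ⟨fun v hv => by rw [phi₁_vertices₁ v hv, phi₂_vertices₁ v hv]; norm_num,
      fun v hv => by rw [phi₁_vertices₂ v hv, phi₂_vertices₂ v hv]; norm_num⟩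
  have key : ∀ v ∈ nablaVertices, u ⬝ᵥ toReal v = -1 →
      (∀ k, a k * (pairing (slopes₁ k) (toReal v) + phi₁ (toReal v)) = 0) ∧
      ∀ k, b k * (pairing (slopes₂ k) (toReal v) + phi₂ (toReal v)) = 0 := by
    intro v hv huv
    have h1 : ∀ k, 0 ≤ a k * (pairing (slopes₁ k) (toReal v) + phi₁ (toReal v)) := fun k =>
      mul_nonneg (ha k) (by linarith [le_phi₁ (toReal v) k])
    have h2 : ∀ k, 0 ≤ b k * (pairing (slopes₂ k) (toReal v) + phi₂ (toReal v)) := fun k =>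
      mul_nonneg (hb k) (by linarith [le_phi₂ (toReal v) k])
    have h3 : ∑ k, a k * (pairing (slopes₁ k) (toReal v) + phi₁ (toReal v)) +
        ∑ k, b k * (pairing (slopes₂ k) (toReal v) + phi₂ (toReal v)) = 0 := by
      simp only [mul_add, Finset.sum_add_distrib, ← Finset.sum_mul, ha1, hb1]
      have := hab (toReal v)
      have := hone v hv
      linarith
    have s1 := Finset.sum_nonneg fun k (_ : k ∈ Finset.univ) => h1 k
    have s2 := Finset.sum_nonneg fun k (_ : k ∈ Finset.univ) => h2 k
    constructor
    · intro k
      exact (Finset.sum_eq_zero_iff_of_nonneg fun k _ => h1 k).mp (by linarith) k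
        (Finset.mem_univ k)
    · intro k
      exact (Finset.sum_eq_zero_iff_of_nonneg fun k _ => h2 k).mp (by linarith) k
        (Finset.mem_univ k)
  have hpair : ∀ s t : Fin 5 → ℤ, (∀ v ∈ nablaVertices, u ⬝ᵥ toReal v = -1 →
      pairing s (toReal v) ≤ pairing t (toReal v)) →
      ∀ x ∈ PointedCone.hull ℝ (supportFace nablaVertices u), -pairing t x ≤ -pairing s x := by
    intro s t hst x hx
    rw [hull_supportFace hu] at hx
    have := nonneg_on_hull (u := toReal t - toReal s) (by
      rintro _ ⟨v, ⟨hv, huv⟩, rfl⟩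
      rw [sub_dotProduct]
      exact sub_nonneg.mpr (hst v hv huv)) x hx
    rw [sub_dotProduct] at this
    exact neg_le_neg (sub_nonneg.mp this)
  constructor
  · obtain ⟨k, -, hk⟩ : ∃ k ∈ Finset.univ, a k ≠ 0 :=
      Finset.exists_ne_zero_of_sum_ne_zero (by rw [ha1]; norm_num)
    refine ⟨slopes₁ k, fun x hx => le_antisymm (phi₁_le fun j => ?_) (le_phi₁ x k)⟩
    refine hpair _ _ (fun v hv huv => ?_) x hx
    have h1 := (mul_eq_zero.mp ((key v hv huv).1 k)).resolve_left hk
    have h2 := le_phi₁ (toReal v) j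
    linarith
  · obtain ⟨k, -, hk⟩ : ∃ k ∈ Finset.univ, b k ≠ 0 :=
      Finset.exists_ne_zero_of_sum_ne_zero (by rw [hb1]; norm_num)
    refine ⟨slopes₂ k, fun x hx => le_antisymm (phi₂_le fun j => ?_) (le_phi₂ x k)⟩
    refine hpair _ _ (fun v hv huv => ?_) x hx
    have h1 := (mul_eq_zero.mp ((key v hv huv).2 k)).resolve_left hk
    have h2 := le_phi₂ (toReal v) j
    linarith

/-- The piecewise linear function `φ¹` on `Σ(∇)`, which is `1` on the vertices of `∇₁` and `0` on
the vertices of `∇₂` (`phi₁_vertices₁`, `phi₁_vertices₂`). Its line bundle is `𝓛₁`. -/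
def nef₁ : SupportFunction nablaFan where
  toFun := phi₁
  linear := by
    rintro σ ⟨f, hf, rfl⟩
    obtain ⟨u, hu, rfl⟩ := exists_supportFace zero_mem_interior_nabla hf
    exact (phi_linear hu).1

/-- The piecewise linear function `φ²` on `Σ(∇)`, which is `0` on the vertices of `∇₁` and `1` on
the vertices of `∇₂` (`phi₂_vertices₁`, `phi₂_vertices₂`). Its line bundle is `𝓛₂`. -/
def nef₂ : SupportFunction nablaFan where
  toFun := phi₂
  linear := by
    rintro σ ⟨f, hf, rfl⟩
    obtain ⟨u, hu, rfl⟩ := exists_supportFace zero_mem_interior_nabla hf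
    exact (phi_linear hu).2

end Toric

end

/-!
On the orbit `T(σ)` the monomial section `z^m` of `𝓛_φ` is the character `χ^{m - m_σ}`, which is
nowhere zero if `m - m_σ ∈ σ^⊥`, i.e. if `φ = -⟨m, ·⟩` on `σ`, and identically zero otherwise
(`SupportFunction.disjoint_orbit_zeroLocus`, `SupportFunction.orbit_subset_zeroLocus`). So both
claims are about the linear forms computing `φ²` on the cones outside `Σ'(∇)`.

The function `φ²` is the maximum of three integral linear forms, and the lattice points of its
Newton polytope are the three corresponding slopes `0`, `(0,0,0,0,1)` and `(-1,-1,-1,-1,-1)`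
(`exists_eq_slopes₂`). A cone outside `Σ'(∇)` contains `-e₅`, `e₅`, or both endpoints of the
excluded segment, hence a point where one of these forms is strictly larger than the other two;
since `φ²` is linear on the cone, that form alone computes `φ²` there (`exists_phi₂_eq_iff`). This
is the second claim; that a monomial vanishing on `T(σ)` is not also disjoint from it uses that
orbits are nonempty (`Fan.orbit_nonempty`).

For the first claim, a global section of `𝓛₂` has a Laurent expansion (`SupportFunction.laurent`)
supported on these three slopes, so on an orbit outside `X(Σ'(∇))` it agrees with a single term,
which vanishes nowhere if its coefficient is nonzero
(`SupportFunction.disjoint_orbit_zeroLocus_of_unique`). As the orbits cover `X(∇)`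
(`Fan.exists_mem_orbit`), it suffices that all three coefficients of `s₂` are nonzero, which is a
Zariski open condition on `s₂`.
-/

namespace Toric

/-! ### Laurent expansion of global sections -/

section laurent

variable {n : ℕ}

/-- The inclusion `ℂ[σ^∨ ∩ M] → ℂ[M]`: a regular function on `U_σ` as a Laurent polynomial. -/
noncomputable def toLaurent (σ : PointedCone ℝ (Fin n → ℝ)) :
    CoordRing σ →ₐ[ℂ] AddMonoidAlgebra ℂ (Fin n → ℤ) :=
  AddMonoidAlgebra.mapDomainAlgHom ℂ ℂ (dualSemigroup σ).subtype

lemma toLaurent_single {σ : PointedCone ℝ (Fin n → ℝ)} (w : dualSemigroup σ) (c : ℂ) :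
    toLaurent σ (AddMonoidAlgebra.single w c) = AddMonoidAlgebra.single w.1 c := by
  simp [toLaurent, AddMonoidAlgebra.mapDomain_single]

lemma coeff_toLaurent {σ : PointedCone ℝ (Fin n → ℝ)} (x : CoordRing σ) (w : dualSemigroup σ) :
    (toLaurent σ x).coeff w.1 = x.coeff w :=
  Finsupp.mapDomain_apply Subtype.val_injective x.coeff w

lemma mem_dualSemigroup_of_coeff_ne_zero {σ : PointedCone ℝ (Fin n → ℝ)} {x : CoordRing σ}
    {w : Fin n → ℤ} (h : (toLaurent σ x).coeff w ≠ 0) : w ∈ dualSemigroup σ := by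
  by_contra hw
  refine h (Finsupp.mapDomain_of_notMem_range x.coeff w ?_)
  rintro ⟨w, rfl⟩
  exact hw w.2

lemma toLaurent_restrict {τ σ : PointedCone ℝ (Fin n → ℝ)} (h : τ ≤ σ) (x : CoordRing σ) :
    toLaurent τ (restrict h x) = toLaurent σ x := by
  induction x using AddMonoidAlgebra.induction_linear with
  | zero => simp
  | add f g hf hg => simp only [map_add, hf, hg]
  | single m r =>
    simp only [restrict, toLaurent, AddMonoidAlgebra.mapDomainAlgHom_apply,
      AddMonoidAlgebra.mapDomain_single]
    rfl

namespace SupportFunction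

variable {F : Fan n} {φ : SupportFunction F}

/-- The rational function `g_σ χ^{m_σ}` does not depend on the chart. -/
lemma single_mul_toLaurent_eq (g : φ.GlobalSections) (σ τ : F.cones) :
    AddMonoidAlgebra.single (φ.slope σ) 1 * toLaurent σ.1 (g.1 σ) =
      AddMonoidAlgebra.single (φ.slope τ) 1 * toLaurent τ.1 (g.1 τ) := by
  have key : ∀ {ρ σ : F.cones}, ρ ≤ σ →
      AddMonoidAlgebra.single (φ.slope σ) 1 * toLaurent σ.1 (g.1 σ) =
        AddMonoidAlgebra.single (φ.slope ρ) 1 * toLaurent ρ.1 (g.1 ρ) := by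
    intro ρ σ h
    have h1 := congrArg (toLaurent ρ.1) (g.2 ρ σ h)
    rw [toLaurent_restrict, map_mul, transition, chi, toLaurent_single] at h1
    rw [h1, ← mul_assoc, AddMonoidAlgebra.single_mul_single]
    simp
  let ρ : F.cones := ⟨σ.1 ⊓ τ.1, F.inf_mem σ.2 τ.2⟩
  rw [key (show ρ ≤ σ from (inf_le_left : σ.1 ⊓ τ.1 ≤ σ.1)),
    key (show ρ ≤ τ from (inf_le_right : σ.1 ⊓ τ.1 ≤ τ.1))]

variable (φ) in
/-- The Laurent expansion of a global section of `𝓛_φ`: the rational function `g_σ χ^{m_σ}`,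
computed in an arbitrary chart (`laurent_eq`). -/
noncomputable def laurent : φ.GlobalSections →ₗ[ℂ] AddMonoidAlgebra ℂ (Fin n → ℤ) :=
  let σ : F.cones := ⟨F.nonempty.some, F.nonempty.some_mem⟩
  LinearMap.mulLeft ℂ (AddMonoidAlgebra.single (φ.slope σ) 1) ∘ₗ (toLaurent σ.1).toLinearMap ∘ₗ
    LinearMap.proj σ ∘ₗ φ.GlobalSections.subtype

lemma laurent_eq (g : φ.GlobalSections) (σ : F.cones) :
    φ.laurent g = AddMonoidAlgebra.single (φ.slope σ) 1 * toLaurent σ.1 (g.1 σ) :=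
  single_mul_toLaurent_eq g _ σ

lemma coeff_laurent (g : φ.GlobalSections) (σ : F.cones) (w : Fin n → ℤ) :
    (φ.laurent g).coeff (w + φ.slope σ) = (toLaurent σ.1 (g.1 σ)).coeff w := by
  rw [laurent_eq g σ, add_comm w, AddMonoidAlgebra.coeff_single_mul_add, one_mul]

lemma laurent_monomialSection (m : φ.newtonPoints) :
    φ.laurent (φ.monomialSection m) = AddMonoidAlgebra.single m.1 1 := by
  let σ : F.cones := ⟨F.nonempty.some, F.nonempty.some_mem⟩
  have h : (φ.monomialSection m).1 σ = AddMonoidAlgebra.single ⟨m.1 - φ.slope σ,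
    φ.sub_slope_mem m.2 σ⟩ 1 := rfl
  rw [laurent_eq _ σ, h, toLaurent_single, AddMonoidAlgebra.single_mul_single]
  simp

/-- The exponents occurring in a global section lie in the Newton polytope, as far as it is
defined by vectors in the support of the fan. -/
lemma neg_le_pairing_of_coeff_ne_zero {g : φ.GlobalSections} {m : Fin n → ℤ}
    (h : (φ.laurent g).coeff m ≠ 0) {σ : F.cones} {v : Fin n → ℝ} (hv : v ∈ σ.1) :
    -φ.toFun v ≤ pairing m v := by
  rw [← sub_add_cancel m (φ.slope σ), coeff_laurent] at h
  have h1 := mem_dualSemigroup_of_coeff_ne_zero h v hv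
  rw [pairing_sub] at h1
  linarith [φ.slope_spec σ v hv]

end SupportFunction

end laurent

/-! ### Torus orbits -/

namespace Fan

variable {n : ℕ} (F : Fan n)

/-- The point of `T(σ)` at which every character `χ^m` with `m ∈ σ^⊥` takes the value `1`. -/
lemma orbit_nonempty (σ : F.cones) : (F.orbit σ).Nonempty := by
  classical
  let e : Multiplicative (dualSemigroup σ.1) →* ℂ :=
    { toFun := fun m => if ∀ v ∈ σ.1, pairing m.toAdd.1 v = 0 then 1 else 0
      map_one' := if_pos fun v _ => pairing_zero v
      map_mul' := fun a b => by
        -- a sum of two characters nonnegative on `σ` vanishes on `σ` only if both do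
        have key : (∀ v ∈ σ.1, pairing (a * b).toAdd.1 v = 0) ↔
            (∀ v ∈ σ.1, pairing a.toAdd.1 v = 0) ∧ ∀ v ∈ σ.1, pairing b.toAdd.1 v = 0 := by
          have hadd : ∀ v, pairing (a * b).toAdd.1 v =
              pairing a.toAdd.1 v + pairing b.toAdd.1 v := fun v => pairing_add _ _ v
          simp only [hadd]
          refine ⟨fun h => ⟨fun v hv => ?_, fun v hv => ?_⟩, fun h v hv => ?_⟩
          · linarith [h v hv, a.toAdd.2 v hv, b.toAdd.2 v hv]
          · linarith [h v hv, a.toAdd.2 v hv, b.toAdd.2 v hv]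
          · rw [h.1 v hv, h.2 v hv, add_zero]
        simp only [key]
        split_ifs <;> simp_all }
  let ε : CoordRing σ.1 →ₐ[ℂ] ℂ := AddMonoidAlgebra.lift ℂ ℂ _ e
  have hε : ∀ m, ε (chi m) = if ∀ v ∈ σ.1, pairing m.1 v = 0 then 1 else 0 := by
    intro m
    simp [ε, chi, AddMonoidAlgebra.lift_single, e]
  let y : PrimeSpectrum (CoordRing σ.1) := ⟨RingHom.ker ε, RingHom.ker_isPrime _⟩
  refine ⟨F.chart σ y, y, fun m => ?_, rfl⟩
  change chi m ∉ RingHom.ker ε ↔ _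
  rw [RingHom.mem_ker, hε]
  split_ifs with h
  · exact iff_of_true one_ne_zero h
  · exact iff_of_false (not_not.mpr rfl) h

/-- The toric variety is the union of its torus orbits: a point lies in the orbit of any cone
that is minimal among those whose chart contains the point. -/
lemma exists_mem_orbit (x : F.variety) : ∃ σ, x ∈ F.orbit σ := by
  obtain ⟨σ₀, y₀, h₀⟩ := F.exists_chart x
  obtain ⟨σ, ⟨y, rfl⟩, hmin⟩ :=
    (Set.toFinite {σ : F.cones | ∃ y, F.chart σ y = x}).exists_minimal ⟨σ₀, y₀, h₀⟩
  refine ⟨σ, y, fun m => ⟨fun hm => ?_, fun hm hy => ?_⟩, rfl⟩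
  · let τ₀ : PointedCone ℝ (Fin n → ℝ) :=
      { carrier := {v | v ∈ σ.1 ∧ pairing m.1 v = 0}
        zero_mem' := ⟨zero_mem _, by simp [pairing]⟩
        add_mem' := fun {a b} ha hb => ⟨add_mem ha.1 hb.1, by
          have h1 := ha.2
          have h2 := hb.2
          simp only [pairing] at h1 h2 ⊢
          rw [dotProduct_add, h1, h2, add_zero]⟩
        smul_mem' := fun c a ha => ⟨Submodule.smul_mem _ c ha.1, by
          have h1 := ha.2
          have h2 : c • a = (c : ℝ) • a := rfl
          simp only [pairing] at h1 ⊢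
          rw [h2, dotProduct_smul, h1, smul_zero]⟩ }
    have hτ : τ₀ ∈ F.cones := F.face_mem σ.1 σ.2 τ₀ ⟨toReal m.1, m.2, fun v => Iff.rfl⟩
    let τ : F.cones := ⟨τ₀, hτ⟩
    have hle : τ ≤ σ := fun v hv => hv.1
    have hcuts : Cuts m.1 τ.1 σ.1 := ⟨m.2, fun v hv => ⟨fun h => h.2, fun h => ⟨hv, h⟩⟩⟩
    obtain ⟨z, rfl⟩ := (F.range_diagram_map (homOfLE hle) hcuts y).mpr hm
    have hz : F.chart τ z = F.chart σ (F.diagram.map (homOfLE hle) z) :=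
      F.chart_eq_iff.mpr ⟨τ, le_rfl, hle, z, by
        rw [show homOfLE (le_refl τ) = 𝟙 τ from rfl, F.diagram.map_id]; rfl, rfl⟩
    exact fun v hv => (hmin ⟨z, hz⟩ hle hv).2
  · have hneg : -m.1 ∈ dualSemigroup σ.1 := fun v hv => by
      rw [pairing_neg, hm v hv, neg_zero]
    have hunit : chi m * chi ⟨-m.1, hneg⟩ = 1 := by
      rw [chi_mul, ← chi_zero]
      congr 1
      apply Subtype.ext
      simp
    have hp : (PrimeSpectrum.asIdeal (R := CoordRing σ.1) y).IsPrime := PrimeSpectrum.isPrime _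
    refine hp.ne_top ((Ideal.eq_top_iff_one _).mpr ?_)
    rw [← hunit]
    exact Ideal.mul_mem_right _ _ hy

end Fan

/-! ### Sections restricted to orbits -/

namespace SupportFunction

variable {n : ℕ} {F : Fan n} {φ : SupportFunction F}

lemma pairing_sub_slope_eq_zero_iff (m : Fin n → ℤ) (σ : F.cones) :
    (∀ v ∈ σ.1, pairing (m - φ.slope σ) v = 0) ↔ ∀ v ∈ σ.1, φ.toFun v = -pairing m v := by
  refine forall₂_congr fun v hv => ?_
  rw [pairing_sub, φ.slope_spec σ v hv, sub_eq_zero, neg_inj, eq_comm]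

lemma disjoint_orbit_zeroLocus (m : φ.newtonPoints) {σ : F.cones}
    (h : ∀ v ∈ σ.1, φ.toFun v = -pairing m.1 v) :
    Disjoint (F.orbit σ) (zeroLocus (φ.monomialSection m)) := by
  rw [Set.disjoint_left]
  rintro _ ⟨y, hy, rfl⟩
  rw [chart_mem_zeroLocus]
  exact (hy _).mpr ((pairing_sub_slope_eq_zero_iff m.1 σ).mpr h)

lemma orbit_subset_zeroLocus (m : φ.newtonPoints) {σ : F.cones}
    (h : ¬ ∀ v ∈ σ.1, φ.toFun v = -pairing m.1 v) :
    F.orbit σ ⊆ zeroLocus (φ.monomialSection m) := by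
  rintro _ ⟨y, hy, rfl⟩
  rw [chart_mem_zeroLocus]
  by_contra h'
  exact h ((pairing_sub_slope_eq_zero_iff m.1 σ).mp ((hy _).mp h'))

lemma disjoint_orbit_zeroLocus_iff (m : φ.newtonPoints) (σ : F.cones) :
    Disjoint (F.orbit σ) (zeroLocus (φ.monomialSection m)) ↔
      ∀ v ∈ σ.1, φ.toFun v = -pairing m.1 v := by
  refine ⟨fun h => ?_, disjoint_orbit_zeroLocus m⟩
  by_contra h'
  obtain ⟨x, hx⟩ := F.orbit_nonempty σ
  exact Set.disjoint_left.mp h hx (orbit_subset_zeroLocus m h' hx)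

/-- If exactly one of the monomials of `g` restricts to a nonzero function on `T(σ)`, then `g`
vanishes nowhere on `T(σ)`, where it is a nonzero multiple of that monomial. -/
lemma disjoint_orbit_zeroLocus_of_unique {g : φ.GlobalSections} {σ : F.cones} {m₀ : Fin n → ℤ}
    (h₀ : (φ.laurent g).coeff m₀ ≠ 0) (hm₀ : ∀ v ∈ σ.1, φ.toFun v = -pairing m₀ v)
    (huniq : ∀ m, (φ.laurent g).coeff m ≠ 0 → (∀ v ∈ σ.1, φ.toFun v = -pairing m v) → m = m₀) :
    Disjoint (F.orbit σ) (zeroLocus g) := by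
  classical
  rw [Set.disjoint_left]
  rintro _ ⟨y, hy, rfl⟩
  rw [chart_mem_zeroLocus]
  intro hg
  have hw₀ : (toLaurent σ.1 (g.1 σ)).coeff (m₀ - φ.slope σ) ≠ 0 := by
    rwa [← coeff_laurent, sub_add_cancel]
  let w₀ : dualSemigroup σ.1 := ⟨_, mem_dualSemigroup_of_coeff_ne_zero hw₀⟩
  have hc : (g.1 σ).coeff w₀ ≠ 0 := by rwa [← coeff_toLaurent]
  have hsingle : ∀ (w : dualSemigroup σ.1) (c : ℂ),
      (AddMonoidAlgebra.single w c : CoordRing σ.1) = c • chi w := by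
    intro w c
    simp [chi]
  have hrest : g.1 σ - AddMonoidAlgebra.single w₀ ((g.1 σ).coeff w₀) ∈
      PrimeSpectrum.asIdeal (R := CoordRing σ.1) y := by
    have hsum : g.1 σ = ∑ w ∈ (g.1 σ).coeff.support,
        AddMonoidAlgebra.single w ((g.1 σ).coeff w) := (AddMonoidAlgebra.sum_coeff_single _).symm
    nth_rewrite 1 [hsum]
    rw [← Finset.add_sum_erase _ _ (Finsupp.mem_support_iff.mpr hc), add_sub_cancel_left]
    refine Ideal.sum_mem _ fun w hw => ?_
    obtain ⟨hne, hw⟩ := Finset.mem_erase.mp hw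
    rw [hsingle]
    refine Submodule.smul_of_tower_mem _ _ ?_
    by_contra hchi
    refine hne (Subtype.ext ?_)
    have hw' : (φ.laurent g).coeff (w.1 + φ.slope σ) ≠ 0 := by
      rw [coeff_laurent, coeff_toLaurent]
      exact Finsupp.mem_support_iff.mp hw
    have hperp := (hy w).mp hchi
    rw [← add_sub_cancel_right w.1 (φ.slope σ), pairing_sub_slope_eq_zero_iff] at hperp
    exact eq_sub_of_add_eq (huniq _ hw' hperp)
  have hlead := sub_mem hg hrest
  rw [sub_sub_cancel] at hlead
  rw [hsingle] at hlead
  refine (hy w₀).mpr ((pairing_sub_slope_eq_zero_iff m₀ σ).mpr hm₀) ?_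
  have := Submodule.smul_of_tower_mem (PrimeSpectrum.asIdeal (R := CoordRing σ.1) y)
    ((g.1 σ).coeff w₀)⁻¹ hlead
  rwa [smul_smul, inv_mul_cancel₀ hc, one_smul] at this

end SupportFunction

/-! ### Combinatorics of `∇` -/

lemma slopes₂_mem_newtonPoints (k : Fin 3) : slopes₂ k ∈ nef₂.newtonPoints :=
  fun v => neg_le.mp (le_phi₂ v k)

/-- A lattice point satisfying the inequalities of `Newt(φ²)` at the vertices of `∇` is one of the
three slopes of `φ²`. -/
lemma exists_eq_slopes₂ {m : Fin 5 → ℤ}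
    (h : ∀ v ∈ nablaVertices, -phi₂ (toReal v) ≤ pairing m (toReal v)) : ∃ k, m = slopes₂ k := by
  rw [forall_nablaVertices] at h
  obtain ⟨h₁, h₂⟩ := h
  have h₁' : ∀ v ∈ nablaVertices₁, 0 ≤ ∑ i, m i * v i := fun v hv => by
    have := h₁ v hv
    rw [phi₂_vertices₁ v hv, neg_zero, pairing_toReal] at this
    exact_mod_cast this
  have h₂' : ∀ v ∈ nablaVertices₂, -1 ≤ ∑ i, m i * v i := fun v hv => by
    have := h₂ v hv
    rw [phi₂_vertices₂ v hv, pairing_toReal] at this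
    exact_mod_cast this
  simp only [nablaVertices₁, nablaVertices₂, Finset.forall_mem_insert, Finset.mem_singleton,
    forall_eq] at h₁' h₂'
  simp [Fin.sum_univ_five] at h₁' h₂'
  have hm : (m 0 = 0 ∧ m 1 = 0 ∧ m 2 = 0 ∧ m 3 = 0 ∧ m 4 = 0) ∨
      (m 0 = 0 ∧ m 1 = 0 ∧ m 2 = 0 ∧ m 3 = 0 ∧ m 4 = 1) ∨
      (m 0 = -1 ∧ m 1 = -1 ∧ m 2 = -1 ∧ m 3 = -1 ∧ m 4 = -1) := by
    omega
  rcases hm with ⟨a, b, c, d, e⟩ | ⟨a, b, c, d, e⟩ | ⟨a, b, c, d, e⟩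
  · exact ⟨0, by ext i; fin_cases i <;> simp [slopes₂, *]⟩
  · exact ⟨1, by ext i; fin_cases i <;> simp [slopes₂, *]⟩
  · exact ⟨2, by ext i; fin_cases i <;> simp [slopes₂, *]⟩

/-- Every vertex `v` of `∇` lies in a cone of `Σ(∇)`: if `s` and `t` are slopes of `φ¹` and `φ²`
attaining the two maxima at `v`, then `s + t ≥ -1` on `∇`, with equality at `v`. -/
lemma exists_cone_of_vertex {v : Fin 5 → ℤ} (hv : v ∈ nablaVertices) :
    ∃ σ : nablaFan.cones, toReal v ∈ σ.1 := by
  obtain ⟨k, hk⟩ := Finite.exists_max fun k => -pairing (slopes₁ k) (toReal v)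
  obtain ⟨l, hl⟩ := Finite.exists_max fun l => -pairing (slopes₂ l) (toReal v)
  have hone : ∀ w ∈ nablaVertices, phi₁ (toReal w) + phi₂ (toReal w) = 1 := by
    rw [forall_nablaVertices]
    exact ⟨fun w hw => by rw [phi₁_vertices₁ w hw, phi₂_vertices₁ w hw]; norm_num,
      fun w hw => by rw [phi₁_vertices₂ w hw, phi₂_vertices₂ w hw]; norm_num⟩
  have hu : ∀ w ∈ nablaVertices, -1 ≤ toReal (slopes₁ k + slopes₂ l) ⬝ᵥ toReal w := by
    intro w hw
    change -1 ≤ pairing (slopes₁ k + slopes₂ l) (toReal w)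
    rw [pairing_add]
    linarith [hone w hw, le_phi₁ (toReal w) k, le_phi₂ (toReal w) l]
  refine ⟨⟨_, _, isProperFace_supportFace (interior_subset zero_mem_interior_nabla) hu, rfl⟩,
    PointedCone.subset_hull ⟨toReal_mem_polytope hv, le_antisymm ?_ (hu v hv)⟩⟩
  change pairing (slopes₁ k + slopes₂ l) (toReal v) ≤ -1
  rw [pairing_add]
  linarith [hone v hv, phi₁_le hk, phi₂_le hl]

/-- If one of the three linear forms whose maximum is `φ²` exceeds the other two at a point `p` of
a cone `σ` of `Σ(∇)`, then it is the only one agreeing with `φ²` on `σ`: for `v ∈ σ` it also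
computes `φ²` at `N p + v` for large `N`, and `φ²` is additive on `σ`. -/
lemma phi₂_eq_iff_of_dominant {σ : PointedCone ℝ (Fin 5 → ℝ)} (hσ : σ ∈ nablaFan.cones)
    {p : Fin 5 → ℝ} (hp : p ∈ σ) {k : Fin 3}
    (hk : ∀ j, j ≠ k → pairing (slopes₂ k) p < pairing (slopes₂ j) p) (j : Fin 3) :
    (∀ v ∈ σ, phi₂ v = -pairing (slopes₂ j) v) ↔ j = k := by
  have hphi : ∀ x, (∀ j, pairing (slopes₂ k) x ≤ pairing (slopes₂ j) x) →
      phi₂ x = -pairing (slopes₂ k) x := fun x hx =>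
    le_antisymm (phi₂_le fun j => neg_le_neg (hx j)) (le_phi₂ x k)
  have hpk : phi₂ p = -pairing (slopes₂ k) p :=
    hphi p fun j => by
      by_cases h : j = k
      · rw [h]
      · exact (hk j h).le
  constructor
  · intro h
    by_contra hjk
    linarith [h p hp, hk j hjk]
  · rintro rfl v hv
    obtain ⟨m, hm⟩ := nef₂.linear σ hσ
    have hlin : ∀ (s : Fin 5 → ℤ) (N : ℕ),
        pairing s ((N : ℝ) • p + v) = N * pairing s p + pairing s v := fun s N => by
      simp only [pairing, dotProduct_add, dotProduct_smul, smul_eq_mul]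
    obtain ⟨N, hN⟩ : ∃ N : ℕ, ∀ i, pairing (slopes₂ j) ((N : ℝ) • p + v) ≤
        pairing (slopes₂ i) ((N : ℝ) • p + v) := by
      have : ∀ᶠ N : ℕ in Filter.atTop, ∀ i, pairing (slopes₂ j) ((N : ℝ) • p + v) ≤
          pairing (slopes₂ i) ((N : ℝ) • p + v) := by
        rw [Filter.eventually_all]
        intro i
        by_cases h : i = j
        · simp [h]
        · have hpos : 0 < pairing (slopes₂ i) p - pairing (slopes₂ j) p := sub_pos.mpr (hk i h)
          have htend := tendsto_natCast_atTop_atTop.atTop_mul_const hpos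
          filter_upwards [htend.eventually_ge_atTop
            (pairing (slopes₂ j) v - pairing (slopes₂ i) v)] with N hN
          rw [hlin, hlin]
          linarith
      exact this.exists
    have hmem : (N : ℝ) • p + v ∈ σ := add_mem (PointedCone.smul_mem _ N.cast_nonneg hp) hv
    have h1 := hphi _ hN
    have h2 : phi₂ _ = _ := hm _ hmem
    have h3 : phi₂ _ = _ := hm _ hp
    have h4 : phi₂ _ = _ := hm _ hv
    rw [hlin] at h1 h2
    have h5 : pairing m p = pairing (slopes₂ j) p := by linarith
    rw [h5] at h2
    linarith

/-- On a cone outside `Σ'(∇)` exactly one of the three slopes computes `φ²`: at `-e₅`, at `e₅`, and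
at the sum of the endpoints of the excluded segment, one of the linear forms exceeds the other
two. -/
lemma exists_phi₂_eq_iff {σ : PointedCone ℝ (Fin 5 → ℝ)} (hσ : σ ∈ nablaFan.cones)
    (hσ' : σ ∉ nablaSubfan.cones) :
    ∃ k, ∀ j, (∀ v ∈ σ, phi₂ v = -pairing (slopes₂ j) v) ↔ j = k := by
  obtain ⟨f, hf, rfl⟩ := id hσ
  have hA : ¬ IsAllowedFace f := fun h => hσ' ⟨f, hf, h, rfl⟩
  simp only [IsAllowedFace, not_and_or, not_not] at hA
  rcases hA with h | h | h
  · refine ⟨1, phi₂_eq_iff_of_dominant hσ (PointedCone.subset_hull h) fun j hj => ?_⟩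
    fin_cases j <;>
      simp_all [slopes₂, pairing, toReal, dotProduct, Fin.sum_univ_five]
  · refine ⟨2, phi₂_eq_iff_of_dominant hσ (PointedCone.subset_hull h) fun j hj => ?_⟩
    fin_cases j <;>
      simp_all [slopes₂, pairing, toReal, dotProduct, Fin.sum_univ_five]
  · refine ⟨0, phi₂_eq_iff_of_dominant hσ
      (add_mem (PointedCone.subset_hull (h (left_mem_segment ℝ _ _)))
        (PointedCone.subset_hull (h (right_mem_segment ℝ _ _)))) fun j hj => ?_⟩
    fin_cases j <;>
      simp_all [slopes₂, pairing, toReal, dotProduct, Fin.sum_univ_five]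
    norm_num

/-! ### Sections of `𝓛₂` outside `X(Σ'(∇))` -/

lemma exists_eq_slopes₂_of_mem_newtonPoints (m : nef₂.newtonPoints) : ∃ k, m.1 = slopes₂ k :=
  exists_eq_slopes₂ fun v _ => m.2 (toReal v)

lemma exists_eq_slopes₂_of_coeff_ne_zero {s : nef₂.GlobalSections} {m : Fin 5 → ℤ}
    (h : (nef₂.laurent s).coeff m ≠ 0) : ∃ k, m = slopes₂ k :=
  exists_eq_slopes₂ fun _ hv =>
    SupportFunction.neg_le_pairing_of_coeff_ne_zero h (exists_cone_of_vertex hv).choose_spec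

lemma slopes₂_injective : Function.Injective slopes₂ := by decide

/-- A section of `𝓛₂` all of whose coefficients are nonzero has no zeros outside `X(Σ'(∇))`. -/
lemma zeroLocus_subset_of_coeff_ne_zero {s : nef₂.GlobalSections}
    (hs : ∀ k, (nef₂.laurent s).coeff (slopes₂ k) ≠ 0) :
    SupportFunction.zeroLocus s ⊆
      ((Fan.inclusion nablaSubfan nablaFan nablaSubfan_subset).opensRange :
        Set nablaFan.variety) := by
  intro x hx
  obtain ⟨σ, hσ⟩ := nablaFan.exists_mem_orbit x
  by_cases hmem : σ.1 ∈ nablaSubfan.cones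
  · obtain ⟨y, -, rfl⟩ := hσ
    exact ⟨nablaSubfan.chart ⟨σ.1, hmem⟩ y,
      Fan.inclusion_chart_apply nablaSubfan nablaFan nablaSubfan_subset ⟨σ.1, hmem⟩ y⟩
  · obtain ⟨k, hk⟩ := exists_phi₂_eq_iff σ.2 hmem
    refine absurd hx (Set.disjoint_left.mp
      (SupportFunction.disjoint_orbit_zeroLocus_of_unique (hs k) ((hk k).mpr rfl) ?_) hσ)
    intro m hm hperp
    obtain ⟨j, rfl⟩ := exists_eq_slopes₂_of_coeff_ne_zero hm
    rw [(hk j).mp hperp]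

/-- The product of the three coefficients of the second section. -/
noncomputable def coeffProduct (s : nef₁.GlobalSections × nef₂.GlobalSections) : ℂ :=
  ∏ k, (nef₂.laurent s.2).coeff (slopes₂ k)

lemma coeffProduct_mem_polynomialFunctions :
    coeffProduct ∈ polynomialFunctions (nef₁.GlobalSections × nef₂.GlobalSections) := by
  let l (k : Fin 3) : Module.Dual ℂ (nef₁.GlobalSections × nef₂.GlobalSections) :=
    { toFun := fun s => (nef₂.laurent s.2).coeff (slopes₂ k)
      map_add' := fun s t => by simp
      map_smul' := fun c s => by simp }
  have h : coeffProduct = ∏ k, fun s => l k s := by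
    ext s
    rw [Finset.prod_apply]
    rfl
  rw [h]
  exact Subalgebra.prod_mem _ fun k _ => Algebra.subset_adjoin ⟨l k, rfl⟩

lemma coeffProduct_ne_zero : coeffProduct ≠ 0 := by
  -- the section `∑ₖ z^{slopes₂ k}` has all three coefficients equal to `1`
  intro h
  have h1 := congrFun h
    (0, ∑ k, nef₂.monomialSection ⟨slopes₂ k, slopes₂_mem_newtonPoints k⟩)
  simp [coeffProduct, SupportFunction.laurent_monomialSection, Finsupp.single_apply,
    slopes₂_injective.eq_iff] at h1

end Toric

theorem mainTheorem3 :
    Toric.Generically (W := Toric.nef₁.GlobalSections × Toric.nef₂.GlobalSections) (fun s =>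
      Toric.SupportFunction.zeroLocus s.1 ∩ Toric.SupportFunction.zeroLocus s.2 ⊆
        ((Toric.Fan.inclusion Toric.nablaSubfan Toric.nablaFan
          Toric.nablaSubfan_subset).opensRange : Set Toric.nablaFan.variety)) ∧
    ∀ σ : Toric.nablaFan.cones, σ.1 ∉ Toric.nablaSubfan.cones →
      (∃! m : Toric.nef₂.newtonPoints, Disjoint (Toric.nablaFan.orbit σ)
        (Toric.SupportFunction.zeroLocus (Toric.nef₂.monomialSection m))) ∧
      ∀ m : Toric.nef₂.newtonPoints,
        Disjoint (Toric.nablaFan.orbit σ)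
          (Toric.SupportFunction.zeroLocus (Toric.nef₂.monomialSection m)) ∨
        Toric.nablaFan.orbit σ ⊆
          Toric.SupportFunction.zeroLocus (Toric.nef₂.monomialSection m) := by
  refine ⟨⟨Toric.coeffProduct, Toric.coeffProduct_mem_polynomialFunctions,
    Toric.coeffProduct_ne_zero, fun s hs => ?_⟩, fun σ hσ => ⟨?_, fun m => ?_⟩⟩
  · exact Set.inter_subset_right.trans (Toric.zeroLocus_subset_of_coeff_ne_zero fun k =>
      Finset.prod_ne_zero_iff.mp hs k (Finset.mem_univ k))
  · obtain ⟨k, hk⟩ := Toric.exists_phi₂_eq_iff σ.2 hσ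
    refine ⟨⟨Toric.slopes₂ k, Toric.slopes₂_mem_newtonPoints k⟩,
      Toric.SupportFunction.disjoint_orbit_zeroLocus _ ((hk k).mpr rfl), fun m hm => ?_⟩
    obtain ⟨j, hj⟩ := Toric.exists_eq_slopes₂_of_mem_newtonPoints m
    have h := (Toric.SupportFunction.disjoint_orbit_zeroLocus_iff m σ).mp hm
    rw [hj] at h
    exact Subtype.ext (by rw [hj, (hk j).mp h])
  · by_cases h : ∀ v ∈ σ.1, Toric.nef₂.toFun v = -Toric.pairing m.1 v
    · exact .inl (Toric.SupportFunction.disjoint_orbit_zeroLocus m h)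
    · exact .inr (Toric.SupportFunction.orbit_subset_zeroLocus m h)
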